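/- Let $A\in\mathbb R^{m\times n}$ ($m\ge 1$) have linearly independent rows, $b\in\mathbb R^m$, $c\in\mathbb R^n$. Consider the linear program $\min\{c^\top x: Ax=b,\ x\ge 0\}$ and its dual $\max\{b^\top y: A^\top y+s=c,\ s\ge 0\}$. Assume that the primal has a unique optimal solution $x^\star$, that the dual has a unique optimal solution $(y^\star,s^\star)$, and that $Ac=0$. Put $w^\star=(x^\star,s^\star)\in\mathbb R^{2n}$. Unless specified otherwise, $\|\cdot\|$ is the Euclidean norm. Let $\Theta=\{i: x^\star_i>0\}$, and let $B$ and $N$ be the submatrices of $A$ formed by the columns with index in $\Theta$ and not in $\Theta$, respectively. (Then $|\Theta|=m$, $B$ is invertible, and $s^\star_j>0$ for all $j\notin\Theta$.) Let $\lambda_{\max}$ and $\lambda_{\min}$ be the largest and the smallest nonzero singular values of $A$, let $\kappa=\lambda_{\max}/\lambda_{\min}$, and let $$\Phi=\big(\|x^\star\|_1+\|s^\star\|_1\big)\cdot\max\left\{\max_{j\notin\Theta}\frac{\sqrt{\|(B^{-1}N)_{\cdot,j}\|^2+1}}{s^\star_j},\ \max_{i\in\Theta}\frac{\sqrt{\|(B^{-1}N)_{i,\cdot}\|^2+1}}{x^\star_i}\right\},$$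 where the rows of $B^{-1}N$ are indexed by $\Theta$, its columns by the complement of $\Theta$, and a maximum over an empty set is omitted. Restarted PDHG with step sizes $\tau,\sigma>0$ and restart parameter $\beta\in(0,1)$ is the following method. One step maps $z=(x,y)$ to $z'=(x',y')$ with $x'=(x-\tau(c-A^\top y))^+$ and $y'=y+\sigma(b-A(2x'-x))$. Start at $z^{0,0}=(0,0)$. In outer loop $k=0,1,2,\dots$, generate $z^{k,1},z^{k,2},\dots$ from $z^{k,0}$ by such steps, with averages $\bar z^{k,l}=\frac1l\sum_{i=1}^l z^{k,i}$. At the first $l\ge1$ at which the restart condition holds, set $z^{k+1,0}=\bar z^{k,l}$ and begin the next outer loop. The method stops when $z^{k,0}$ is a saddle point of $L(x,y)=c^\top x+b^\top y-(Ax)^\top y$ on $\mathbb R^n_+\times\mathbb R^m$ (minimized in $x$, maximized in $y$). The restart condition holds if $k=0$ and $l=1$, or if $k\ge1$ and $$\rho(\|\bar z^{k,l}-z^{k,0}\|_M;\bar z^{k,l})\le\beta\,\rho(\|z^{k,0}-z^{k-1,0}\|_M;z^{k,0}).$$ Here $\|z\|_M=\sqrt{z^\top Mz}$ with $M=\begin{pmatrix}\frac1\tau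 I&-A^\top\\-A&\frac1\sigma I\end{pmatrix}$, and $$\rho(r;z)=\frac1r\sup\{L(x,\hat y)-L(\hat x,y):\ \hat x\ge0,\ \|(\hat x,\hat y)-z\|_M\le r\}.$$ A pair $w=(x,s)$ is called $\varepsilon$-optimal if its Euclidean distance to the set of pairs of primal optimal solutions and dual optimal slacks, which is here $\{w^\star\}$, is at most $\varepsilon$. Theorem. There is an absolute constant $C>0$ such that, for all such $m,n,A,b,c$ and every $\varepsilon>0$ (in the trivial case $n=1$: every $0<\varepsilon\le\|w^\star\|/2$), restarted PDHG with $\tau=\frac1{2\kappa}$, $\sigma=\frac1{2\lambda_{\max}\lambda_{\min}}$ and $\beta=1/e$ reaches an outer iterate $z^{K,0}=(x^{K,0},y^{K,0})$ for which $w^{K,0}=(x^{K,0},c-A^\top y^{K,0})$ is $\varepsilon$-optimal, after a total of at most $$C\,\kappa\,\Phi\cdot\max\left\{0,\ \ln\left(\kappa\,\Phi\cdot\frac{\|w^\star\|}{\varepsilon}\right)\right\}$$ one-step PDHG iterations. -/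

import Mathlib

open Matrix

noncomputable section

namespace RPDHG

/-! ## Standard-form linear programs

The primal problem is `min c ⬝ x` subject to `A x = b`, `x ≥ 0`; the dual problem is
`max b ⬝ y` subject to `Aᵀ y + s = c`, `s ≥ 0`. -/

/-- The set of optimal solutions of the primal problem. -/
def primalOptima {m n : ℕ} (A : Matrix (Fin m) (Fin n) ℝ) (b : Fin m → ℝ) (c : Fin n → ℝ) :
    Set (Fin n → ℝ) :=
  {x | (A *ᵥ x = b ∧ 0 ≤ x) ∧ ∀ x', A *ᵥ x' = b ∧ 0 ≤ x' → c ⬝ᵥ x ≤ c ⬝ᵥ x'}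

/-- The set of optimal solutions `(y, s)` of the dual problem. -/
def dualOptima {m n : ℕ} (A : Matrix (Fin m) (Fin n) ℝ) (b : Fin m → ℝ) (c : Fin n → ℝ) :
    Set ((Fin m → ℝ) × (Fin n → ℝ)) :=
  {p | (Aᵀ *ᵥ p.1 + p.2 = c ∧ 0 ≤ p.2) ∧
    ∀ y' s', Aᵀ *ᵥ y' + s' = c ∧ 0 ≤ s' → b ⬝ᵥ y' ≤ b ⬝ᵥ p.1}

/-- The pair `(x, s)` as a vector of the Euclidean space of dimension `2n`. -/
def pairVec {n : ℕ} (x s : Fin n → ℝ) : EuclideanSpace ℝ (Fin n ⊕ Fin n) :=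
  WithLp.toLp 2 (Sum.elim x s)

/-- The set of pairs `w = (x, s)` of a primal optimal `x` and a dual optimal slack `s`. -/
def optimalPairs {m n : ℕ} (A : Matrix (Fin m) (Fin n) ℝ) (b : Fin m → ℝ) (c : Fin n → ℝ) :
    Set (EuclideanSpace ℝ (Fin n ⊕ Fin n)) :=
  {w | ∃ x s y, x ∈ primalOptima A b c ∧ (y, s) ∈ dualOptima A b c ∧ w = pairVec x s}

/-- A pair `w = (x, s)` is `ε`-optimal if its Euclidean distance to the set of optimal pairs is at
most `ε`. -/
def EpsOptimal {m n : ℕ} (A : Matrix (Fin m) (Fin n) ℝ) (b : Fin m → ℝ) (c : Fin n → ℝ)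
    (ε : ℝ) (w : EuclideanSpace ℝ (Fin n ⊕ Fin n)) : Prop :=
  Metric.infDist w (optimalPairs A b c) ≤ ε

/-! ## The condition number of the constraint matrix -/

/-- The set of nonzero singular values of `A`. -/
def nonzeroSingularValues {m n : ℕ} (A : Matrix (Fin m) (Fin n) ℝ) : Set ℝ :=
  Set.range (fun i : ℕ => (Matrix.toEuclideanLin A).singularValues i) \ {0}

/-- The largest nonzero singular value. -/
def lamMax {m n : ℕ} (A : Matrix (Fin m) (Fin n) ℝ) : ℝ := sSup (nonzeroSingularValues A)

/-- The smallest nonzero singular value. -/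
def lamMin {m n : ℕ} (A : Matrix (Fin m) (Fin n) ℝ) : ℝ := sInf (nonzeroSingularValues A)

/-- The matrix condition number. -/
def kappa {m n : ℕ} (A : Matrix (Fin m) (Fin n) ℝ) : ℝ := lamMax A / lamMin A

/-! ## The geometric condition number in closed form -/

/-- The support `Θ = {i | x i > 0}` of the primal optimal solution (the optimal basis). -/
def basisSet {n : ℕ} (x : Fin n → ℝ) : Finset (Fin n) := Finset.univ.filter (fun i => 0 < x i)

/-- The index in `Fin n` of the `i`-th element of `Θ` (in increasing order). -/
def basisIdx {m n : ℕ} (x : Fin n → ℝ) (h : (basisSet x).card = m) (i : Fin m) : Fin n :=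
  (basisSet x).orderEmbOfFin h i

/-- The square matrix `B` of the columns of `A` indexed by `Θ`. -/
def basisMat {m n : ℕ} (A : Matrix (Fin m) (Fin n) ℝ) (x : Fin n → ℝ)
    (h : (basisSet x).card = m) : Matrix (Fin m) (Fin m) ℝ :=
  A.submatrix id (basisIdx x h)

/-- The matrix `N` of the columns of `A` indexed by the complement of `Θ`. -/
def nonbasisMat {m n : ℕ} (A : Matrix (Fin m) (Fin n) ℝ) (x : Fin n → ℝ) :
    Matrix (Fin m) {j : Fin n // j ∉ basisSet x} ℝ :=
  A.submatrix id Subtype.val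

/-- The tableau `B⁻¹ N`. -/
def tableau {m n : ℕ} (A : Matrix (Fin m) (Fin n) ℝ) (x : Fin n → ℝ)
    (h : (basisSet x).card = m) : Matrix (Fin m) {j : Fin n // j ∉ basisSet x} ℝ :=
  (basisMat A x h)⁻¹ * nonbasisMat A x

/-- The quantity `Φ`. The suprema are maxima over finite index sets; the one over the nonbasic
indices is dropped (it equals `0`) if there are none. -/
def Phi {m n : ℕ} (A : Matrix (Fin m) (Fin n) ℝ) (x s : Fin n → ℝ)
    (h : (basisSet x).card = m) : ℝ :=
  ((∑ i, |x i|) + ∑ i, |s i|) *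
    max (⨆ j : {j : Fin n // j ∉ basisSet x},
          Real.sqrt ((∑ i, tableau A x h i j ^ 2) + 1) / s j)
        (⨆ i : Fin m,
          Real.sqrt ((∑ j, tableau A x h i j ^ 2) + 1) / x (basisIdx x h i))

/-! ## The restarted primal-dual hybrid gradient method -/

/-- Primal-dual iterates `z = (x, y)`. -/
abbrev Iterate (m n : ℕ) : Type := (Fin n → ℝ) × (Fin m → ℝ)

/-- The Lagrangian `L(x, y) = c ⬝ x + b ⬝ y - (A x) ⬝ y`. -/
def lagrangian {m n : ℕ} (A : Matrix (Fin m) (Fin n) ℝ) (b : Fin m → ℝ) (c : Fin n → ℝ)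
    (x : Fin n → ℝ) (y : Fin m → ℝ) : ℝ :=
  c ⬝ᵥ x + b ⬝ᵥ y - (A *ᵥ x) ⬝ᵥ y

/-- Saddle points of the Lagrangian on `{x ≥ 0} × ℝᵐ`. -/
def IsSaddlePoint {m n : ℕ} (A : Matrix (Fin m) (Fin n) ℝ) (b : Fin m → ℝ) (c : Fin n → ℝ)
    (z : Iterate m n) : Prop :=
  0 ≤ z.1 ∧ (∀ y', lagrangian A b c z.1 y' ≤ lagrangian A b c z.1 z.2) ∧
    ∀ x', 0 ≤ x' → lagrangian A b c z.1 z.2 ≤ lagrangian A b c x' z.2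

/-- One step of the method with step sizes `τ` and `σ`. -/
def onePDHG {m n : ℕ} (A : Matrix (Fin m) (Fin n) ℝ) (b : Fin m → ℝ) (c : Fin n → ℝ)
    (τ σ : ℝ) (z : Iterate m n) : Iterate m n :=
  let x' : Fin n → ℝ := (z.1 - τ • (c - Aᵀ *ᵥ z.2)) ⊔ 0
  (x', z.2 + σ • (b - A *ᵥ ((2 : ℝ) • x' - z.1)))

/-- The inner iterates `z^{n,0} = z, z^{n,1}, z^{n,2}, …` started at `z`. -/
def innerIter {m n : ℕ} (A : Matrix (Fin m) (Fin n) ℝ) (b : Fin m → ℝ) (c : Fin n → ℝ)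
    (τ σ : ℝ) (z : Iterate m n) (k : ℕ) : Iterate m n :=
  (onePDHG A b c τ σ)^[k] z

/-- The average of the inner iterates number `1` to `k`. -/
def innerAvg {m n : ℕ} (A : Matrix (Fin m) (Fin n) ℝ) (b : Fin m → ℝ) (c : Fin n → ℝ)
    (τ σ : ℝ) (z : Iterate m n) (k : ℕ) : Iterate m n :=
  (1 / (k : ℝ)) • ∑ i ∈ Finset.Icc 1 k, innerIter A b c τ σ z i

/-- The matrix `M` with blocks `τ⁻¹ I`, `-Aᵀ`, `-A`, `σ⁻¹ I`. -/
def normMat {m n : ℕ} (A : Matrix (Fin m) (Fin n) ℝ) (τ σ : ℝ) :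
    Matrix (Fin n ⊕ Fin m) (Fin n ⊕ Fin m) ℝ :=
  Matrix.fromBlocks ((1 / τ) • (1 : Matrix (Fin n) (Fin n) ℝ)) (-Aᵀ) (-A)
    ((1 / σ) • (1 : Matrix (Fin m) (Fin m) ℝ))

/-- The norm `‖z‖_M = √(zᵀ M z)`. -/
def mNorm {m n : ℕ} (A : Matrix (Fin m) (Fin n) ℝ) (τ σ : ℝ) (z : Iterate m n) : ℝ :=
  Real.sqrt (Sum.elim z.1 z.2 ⬝ᵥ (normMat A τ σ *ᵥ Sum.elim z.1 z.2))

/-- The normalized duality gap `ρ(r; z)`, for `r > 0`. -/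
def normGap {m n : ℕ} (A : Matrix (Fin m) (Fin n) ℝ) (b : Fin m → ℝ) (c : Fin n → ℝ)
    (τ σ : ℝ) (r : ℝ) (z : Iterate m n) : ℝ :=
  (1 / r) * sSup ((fun z' : Iterate m n =>
      lagrangian A b c z.1 z'.2 - lagrangian A b c z'.1 z.2) ''
    {z' : Iterate m n | 0 ≤ z'.1 ∧ mNorm A τ σ (z' - z) ≤ r})

/-- The `β`-restart condition in outer loop `N` after `k` inner iterations; `zprev` is
`z^{N-1,0}` (not used if `N = 0`) and `z` is `z^{N,0}`. -/
def RestartCond {m n : ℕ} (A : Matrix (Fin m) (Fin n) ℝ) (b : Fin m → ℝ) (c : Fin n → ℝ)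
    (τ σ β : ℝ) (N : ℕ) (zprev z : Iterate m n) (k : ℕ) : Prop :=
  (N = 0 ∧ k = 1) ∨
  (1 ≤ N ∧
    normGap A b c τ σ (mNorm A τ σ (innerAvg A b c τ σ z k - z)) (innerAvg A b c τ σ z k) ≤
      β * normGap A b c τ σ (mNorm A τ σ (z - zprev)) z)

/-- `Reaches A b c τ σ β N T zprev z` says that the restarted method, started at `(0, 0)`,
completes `N` outer loops after `T` calls of `onePDHG` in total, with `z^{N,0} = z` and
`z^{N-1,0} = zprev` (for `N = 0` the entry `zprev` is a dummy). Each inner loop stops at the first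
`k ≥ 1` satisfying the restart condition, and the method stops at a saddle point. -/
inductive Reaches {m n : ℕ} (A : Matrix (Fin m) (Fin n) ℝ) (b : Fin m → ℝ) (c : Fin n → ℝ)
    (τ σ β : ℝ) : ℕ → ℕ → Iterate m n → Iterate m n → Prop
  | start : Reaches A b c τ σ β 0 0 0 0
  | outer {N T k : ℕ} {zprev z : Iterate m n} :
      Reaches A b c τ σ β N T zprev z →
      ¬ IsSaddlePoint A b c z →
      IsLeast {k : ℕ | 1 ≤ k ∧ RestartCond A b c τ σ β N zprev z k} k →
      Reaches A b c τ σ β (N + 1) (T + k) z (innerAvg A b c τ σ z k)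

end RPDHG

end

/-!
The argument is a sharpness estimate for the normalized duality gap combined with the `O(1/k)`
decay of the gap along averaged iterates.

*The metric.* Let `λ_max`, `λ_min` be the extreme nonzero singular values of `A`. With the given
step sizes the weights `1/τ`, `1/σ` are `2κ` and `2 λ_max λ_min`, and the mixed term `2 (A x) ⬝ y`
is at most half of the weighted square (`UniqueOptima.stepBound`). The steps are firmly
nonexpansive in `pdhgSq`, whose mixed term has the opposite sign to the one of `mNorm`; by the bound
on the mixed term the two are equivalent up to a factor `3`, which costs only a constant. Hence
iterates and averages never move away from the saddle point (`pdhgSq_innerAvg_le_start`), and the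
normalized gap of the average of `k` steps is at most `6 r / k`, with `r` the distance of that
average from the starting point (`normGap_innerAvg_le`).

*Geometry of the linear program.* Uniqueness of the primal solution makes the set of strictly
complementary dual cost vectors open, and a separating functional would give another primal
solution, so a strictly complementary dual solution exists; uniqueness of the dual solution
identifies it with `(y, s)` (`strict_complementarity`). It follows that the optimal basis is square
and invertible. A vector of the kernel of `A` is then determined by its nonbasic entries, a vector
of the row space by its basic entries, both through the tableau `B⁻¹ N`, whose columns and rows
enter `Φ`.

*Sharpness.* Testing the normalized gap `g` at `z` with three moves bounds the primal infeasibility,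
the dual infeasibility and the objective gap. The objective gap equals, up to infeasibility, the
complementarity sum of `(x', s')` against the optimal `(x, s)`, which through the tableau bounds the
distance by `O(Φ √κ g)` (`UniqueOptima.error_bound`, `UniqueOptima.sharpness`). The condition
`A c = 0` enters through `‖Aᵀ y‖ ≤ ‖s‖`.

*Counting.* In the metric of the method the distance is `O(κ Φ g)`, so within `O(κ Φ)` iterations
the normalized gap drops by the factor `e` and a restart happens
(`UniqueOptima.exists_isLeast_restart`). The first loop has `g = O(√κ ‖w‖)`, so that
`O(1 + ln (κ Φ ‖w‖ / ε))` loops suffice. Since `Φ ≥ n`, the logarithm is at least `ln 2` unless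
`ε ≥ ‖w‖` (for `n = 1` because then `ε ≤ ‖w‖ / 2`), and if `ε ≥ ‖w‖`, the origin is already
`ε`-optimal.
-/

noncomputable section

namespace RPDHG

/-! ### Euclidean norms and singular values -/

/-- The Euclidean norm of a vector given as a plain function. -/
def euc {ι : Type*} [Fintype ι] (v : ι → ℝ) : ℝ := ‖(WithLp.toLp 2 v : EuclideanSpace ℝ ι)‖

section Euclidean

variable {ι : Type*} [Fintype ι]

lemma euc_nonneg (v : ι → ℝ) : 0 ≤ euc v := norm_nonneg _

lemma euc_sq (v : ι → ℝ) : euc v ^ 2 = v ⬝ᵥ v := by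
  rw [euc, EuclideanSpace.real_norm_sq_eq]
  simp [dotProduct, sq]

lemma euc_eq_zero {v : ι → ℝ} : euc v = 0 ↔ v = 0 := by
  rw [← pow_eq_zero_iff two_ne_zero, euc_sq, dotProduct_self_eq_zero]

lemma euc_add_le (u v : ι → ℝ) : euc (u + v) ≤ euc u + euc v := by
  simpa [euc] using norm_add_le (WithLp.toLp 2 u : EuclideanSpace ℝ ι) (WithLp.toLp 2 v)

lemma euc_sum_smul_le {κ : Type*} [Fintype κ] (a : κ → ℝ) (f : κ → ι → ℝ) :
    euc (∑ j, a j • f j) ≤ ∑ j, |a j| * euc (f j) := by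
  have h := norm_sum_le (Finset.univ) (fun j => a j • (WithLp.toLp 2 (f j) : EuclideanSpace ℝ ι))
  simpa only [euc, WithLp.toLp_sum, WithLp.toLp_smul, norm_smul, Real.norm_eq_abs] using h

lemma abs_dotProduct_le (u v : ι → ℝ) : |u ⬝ᵥ v| ≤ euc u * euc v := by
  have h := abs_real_inner_le_norm (WithLp.toLp 2 v : EuclideanSpace ℝ ι) (WithLp.toLp 2 u)
  rw [EuclideanSpace.inner_eq_star_dotProduct] at h
  simpa [euc, mul_comm] using h

lemma dotProduct_le_euc (u v : ι → ℝ) : u ⬝ᵥ v ≤ euc u * euc v :=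
  (le_abs_self _).trans (abs_dotProduct_le u v)

lemma euc_le_sum_abs (v : ι → ℝ) : euc v ≤ ∑ i, |v i| := by
  refine le_of_sq_le_sq ?_ (Finset.sum_nonneg fun i _ => abs_nonneg _)
  rw [euc_sq, dotProduct]
  simpa [← sq, sq_abs] using
    Finset.sum_sq_le_sq_sum_of_nonneg (s := Finset.univ) (f := fun i => |v i|)
      (fun i _ => abs_nonneg _)

end Euclidean

section SingularValues

variable {m n : ℕ} (A : Matrix (Fin m) (Fin n) ℝ)

lemma transpose_mulVec_dotProduct (u : Fin n → ℝ) (v : Fin m → ℝ) :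
    (Aᵀ *ᵥ v) ⬝ᵥ u = (A *ᵥ u) ⬝ᵥ v := by
  rw [mulVec_transpose, ← dotProduct_mulVec, dotProduct_comm]

lemma mulVec_injective_transpose (hA : LinearIndependent ℝ A.row) :
    Function.Injective (Aᵀ *ᵥ ·) := by
  rw [Matrix.mulVec_injective_iff]
  exact hA

lemma nonzeroSingularValues_finite : (nonzeroSingularValues A).Finite := by
  refine Set.Finite.subset (Set.Finite.image (toEuclideanLin A).singularValues
    (toEuclideanLin A).singularValues.support.finite_toSet) ?_
  rintro _ ⟨⟨i, rfl⟩, hi⟩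
  exact ⟨i, Finsupp.mem_support_iff.mpr hi, rfl⟩

lemma nonzeroSingularValues_pos {t : ℝ} (ht : t ∈ nonzeroSingularValues A) : 0 < t := by
  obtain ⟨⟨i, rfl⟩, hi⟩ := ht
  exact lt_of_le_of_ne ((toEuclideanLin A).singularValues_nonneg i) (Ne.symm hi)

lemma nonzeroSingularValues_nonempty (hm : 0 < m) (hA : LinearIndependent ℝ A.row) :
    (nonzeroSingularValues A).Nonempty := by
  by_contra hne
  have h0 : (toEuclideanLin A).singularValues = 0 := by
    ext i
    by_contra hi
    exact hne ⟨_, ⟨i, rfl⟩, hi⟩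
  rw [LinearMap.singularValues_eq_zero_iff] at h0
  have hA0 : A = 0 := by simpa using h0
  exact hA.ne_zero ⟨0, hm⟩ (by ext j; simp [hA0, Matrix.row])

lemma lamMin_pos (hm : 0 < m) (hA : LinearIndependent ℝ A.row) : 0 < lamMin A :=
  nonzeroSingularValues_pos A
    ((nonzeroSingularValues_nonempty A hm hA).csInf_mem (nonzeroSingularValues_finite A))

lemma lamMin_le_lamMax (hm : 0 < m) (hA : LinearIndependent ℝ A.row) : lamMin A ≤ lamMax A :=
  csInf_le_csSup (nonzeroSingularValues_nonempty A hm hA) (nonzeroSingularValues_finite A).bddBelow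
    (nonzeroSingularValues_finite A).bddAbove

/-- In coordinates `v` of an orthonormal eigenbasis of `AᵀA` with eigenvalues `μ`, the norms of
`x`, `A x` and `AᵀA x` are explicit. -/
lemma exists_spectral_coordinates (x : Fin n → ℝ) :
    ∃ (μ v : Fin n → ℝ),
      (∀ i, μ i = 0 ∨ (0 < μ i ∧ lamMin A ^ 2 ≤ μ i ∧ μ i ≤ lamMax A ^ 2)) ∧
      euc x ^ 2 = ∑ i, v i ^ 2 ∧ euc (A *ᵥ x) ^ 2 = ∑ i, μ i * v i ^ 2 ∧
      euc (Aᵀ *ᵥ (A *ᵥ x)) ^ 2 = ∑ i, μ i ^ 2 * v i ^ 2 := by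
  set T := toEuclideanLin A with hT
  set S := T.adjoint ∘ₗ T with hS
  have hsym : S.IsSymmetric := T.isSymmetric_adjoint_comp_self
  have hn : Module.finrank ℝ (EuclideanSpace ℝ (Fin n)) = n := by simp
  set e := hsym.eigenvectorBasis hn with he
  set X : EuclideanSpace ℝ (Fin n) := WithLp.toLp 2 x with hX
  have hSX : WithLp.toLp 2 (Aᵀ *ᵥ (A *ᵥ x)) = S X := by
    have : T.adjoint = toEuclideanLin Aᵀ := by
      rw [hT, ← toEuclideanLin_conjTranspose_eq_adjoint, conjTranspose_eq_transpose_of_trivial]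
    rw [hS, LinearMap.comp_apply, this, hT, hX, toLpLin_toLp,
      toLpLin_toLp, toLin'_apply, toLin'_apply]
  have hrepr : ∀ i, e.repr (S X) i = hsym.eigenvalues hn i * e.repr X i :=
    fun i => hsym.eigenvectorBasis_apply_self_apply hn X i
  refine ⟨hsym.eigenvalues hn, fun i => e.repr X i, ?_, ?_, ?_, ?_⟩
  · intro i
    have hsq := T.sq_singularValues_fin hn i
    rw [← hsq]
    by_cases h0 : T.singularValues i = 0
    · left; simp [h0]
    · right
      have hmem : T.singularValues i ∈ nonzeroSingularValues A := ⟨⟨i, rfl⟩, h0⟩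
      have hpos := nonzeroSingularValues_pos A hmem
      refine ⟨by positivity, ?_, ?_⟩
      · have hmin : 0 ≤ lamMin A := le_csInf ⟨_, hmem⟩ fun t ht =>
          (nonzeroSingularValues_pos A ht).le
        exact pow_le_pow_left₀ hmin (csInf_le (nonzeroSingularValues_finite A).bddBelow hmem) 2
      · exact pow_le_pow_left₀ hpos.le (le_csSup (nonzeroSingularValues_finite A).bddAbove hmem) 2
  · rw [euc, ← hX, ← e.repr.norm_map X, EuclideanSpace.real_norm_sq_eq]
  · have h1 : euc (A *ᵥ x) ^ 2 = inner ℝ X (S X) := by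
      rw [hS, LinearMap.comp_apply, LinearMap.adjoint_inner_right, real_inner_self_eq_norm_sq, hT,
        hX, toLpLin_toLp, toLin'_apply, euc]
    rw [h1, ← e.repr.inner_map_map, PiLp.inner_apply]
    refine Finset.sum_congr rfl fun i _ => ?_
    rw [hrepr]
    simp only [RCLike.inner_apply, conj_trivial]
    ring
  · rw [euc, hSX, ← e.repr.norm_map, EuclideanSpace.real_norm_sq_eq]
    refine Finset.sum_congr rfl fun i _ => ?_
    rw [hrepr, mul_pow]

lemma euc_mulVec_le (hm : 0 < m) (hA : LinearIndependent ℝ A.row) (x : Fin n → ℝ) :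
    euc (A *ᵥ x) ≤ lamMax A * euc x := by
  obtain ⟨μ, v, hμ, hx, hAx, -⟩ := exists_spectral_coordinates A x
  have hL := (lamMin_pos A hm hA).trans_le (lamMin_le_lamMax A hm hA)
  refine le_of_sq_le_sq ?_ (mul_nonneg hL.le (euc_nonneg _))
  rw [mul_pow, hx, hAx, Finset.mul_sum]
  refine Finset.sum_le_sum fun i _ => mul_le_mul_of_nonneg_right ?_ (sq_nonneg _)
  rcases hμ i with h | h
  · rw [h]; positivity
  · exact h.2.2

lemma exists_mulVec_mulVec_transpose_eq (hA : LinearIndependent ℝ A.row) (u : Fin m → ℝ) :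
    ∃ v, A *ᵥ (Aᵀ *ᵥ v) = u := by
  have hinj : Function.Injective (A * Aᵀ).mulVecLin := by
    rw [← LinearMap.ker_eq_bot, LinearMap.ker_eq_bot']
    intro v hv
    have h0 : A *ᵥ (Aᵀ *ᵥ v) = 0 := by
      rwa [Matrix.mulVecLin_apply, ← Matrix.mulVec_mulVec] at hv
    have h1 : (Aᵀ *ᵥ v) ⬝ᵥ (Aᵀ *ᵥ v) = 0 := by
      rw [transpose_mulVec_dotProduct, h0, zero_dotProduct]
    rw [dotProduct_self_eq_zero] at h1
    exact mulVec_injective_transpose A hA (by simp [h1])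
  obtain ⟨v, hv⟩ := LinearMap.injective_iff_surjective.mp hinj u
  exact ⟨v, by rwa [Matrix.mulVecLin_apply, ← Matrix.mulVec_mulVec] at hv⟩

/-- Every `y` is of the form `A x`, and `‖AᵀA x‖ ≥ λ_min ‖A x‖` holds in spectral coordinates. -/
lemma lamMin_mul_euc_le (hA : LinearIndependent ℝ A.row) (y : Fin m → ℝ) :
    lamMin A * euc y ≤ euc (Aᵀ *ᵥ y) := by
  obtain ⟨w, rfl⟩ := exists_mulVec_mulVec_transpose_eq A hA y
  obtain ⟨μ, v, hμ, -, hAx, hAAx⟩ := exists_spectral_coordinates A (Aᵀ *ᵥ w)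
  refine le_of_sq_le_sq ?_ (euc_nonneg _)
  rw [mul_pow, hAx, hAAx, Finset.mul_sum]
  refine Finset.sum_le_sum fun i _ => ?_
  rw [← mul_assoc]
  refine mul_le_mul_of_nonneg_right ?_ (sq_nonneg _)
  rcases hμ i with h | h
  · simp [h]
  · nlinarith [h.1, h.2.1]

end SingularValues

/-! ### Strict complementarity under unique optima -/

section LinearProgram

open Filter Topology

lemma exists_pos_smul_step {ι : Type*} [Finite ι] {v d : ι → ℝ} (hv : 0 ≤ v)
    (hd : ∀ j, v j = 0 → 0 ≤ d j) : ∃ t : ℝ, 0 < t ∧ 0 ≤ v + t • d := by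
  have h : ∀ᶠ t : ℝ in 𝓝[>] 0, ∀ j, 0 ≤ v j + t * d j := by
    rw [eventually_all]
    intro j
    rcases (hv j).eq_or_lt with h0 | h0
    · filter_upwards [self_mem_nhdsWithin] with t ht
      have := mul_nonneg (le_of_lt ht) (hd j h0.symm)
      rw [← h0]
      simpa using this
    · have hc : Tendsto (fun t : ℝ => v j + t * d j) (𝓝[>] 0) (𝓝 (v j + 0 * d j)) :=
        (Continuous.tendsto (by fun_prop) _).mono_left nhdsWithin_le_nhds
      refine (hc.eventually (lt_mem_nhds (a := 0) (by simpa using h0))).mono fun t ht => le_of_lt ht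
  obtain ⟨t, ht, hpos⟩ := (h.and self_mem_nhdsWithin).exists
  exact ⟨t, hpos, fun j => ht j⟩

lemma exists_eq_dotProduct {ι : Type*} [Fintype ι] (φ : (ι → ℝ) →ₗ[ℝ] ℝ) :
    ∃ d : ι → ℝ, ∀ v, φ v = d ⬝ᵥ v := by
  classical
  refine ⟨fun j => φ (Pi.single j 1), fun v => ?_⟩
  rw [LinearMap.pi_apply_eq_sum_univ φ v, dotProduct]
  refine Finset.sum_congr rfl fun j _ => ?_
  rw [smul_eq_mul, mul_comm]
  congr 2
  ext k
  simp [Pi.single_apply, eq_comm]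

variable {m n : ℕ} {A : Matrix (Fin m) (Fin n) ℝ} {b : Fin m → ℝ} {c x s : Fin n → ℝ}
  {y : Fin m → ℝ}

lemma mem_primalOptima_of_eq (hx : primalOptima A b c = {x}) : x ∈ primalOptima A b c :=
  hx ▸ Set.mem_singleton x

lemma mem_dualOptima_of_eq (hy : dualOptima A b c = {(y, s)}) : (y, s) ∈ dualOptima A b c :=
  hy ▸ Set.mem_singleton (y, s)

lemma cost_pos_of_feasible_direction (hx : primalOptima A b c = {x}) {d : Fin n → ℝ}
    (hA : A *ᵥ d = 0) (hd : ∀ j, x j = 0 → 0 ≤ d j) (h0 : d ≠ 0) : 0 < c ⬝ᵥ d := by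
  obtain ⟨⟨hfx, hx0⟩, hopt⟩ := mem_primalOptima_of_eq hx
  obtain ⟨t, ht, hpos⟩ := exists_pos_smul_step hx0 hd
  have hfeas : A *ᵥ (x + t • d) = b := by
    rw [mulVec_add, mulVec_smul, hA, hfx, smul_zero, add_zero]
  have hval : c ⬝ᵥ (x + t • d) = c ⬝ᵥ x + t * (c ⬝ᵥ d) := by
    rw [dotProduct_add, dotProduct_smul, smul_eq_mul]
  have hge : 0 ≤ c ⬝ᵥ d := by
    have := hopt _ ⟨hfeas, hpos⟩
    rw [hval] at this
    exact nonneg_of_mul_nonneg_right (by linarith) ht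
  refine lt_of_le_of_ne hge fun heq => h0 ?_
  have hmem : x + t • d ∈ primalOptima A b c :=
    ⟨⟨hfeas, hpos⟩, fun x' hx' => by rw [hval, ← heq, mul_zero, add_zero]; exact hopt x' hx'⟩
  rw [hx, Set.mem_singleton_iff, add_eq_left] at hmem
  exact (smul_eq_zero.mp hmem).resolve_left ht.ne'

lemma cost_neg_of_dual_feasible_direction (hy : dualOptima A b c = {(y, s)}) {u : Fin m → ℝ}
    (hd : ∀ j, s j = 0 → (Aᵀ *ᵥ u) j ≤ 0) (h0 : u ≠ 0) : b ⬝ᵥ u < 0 := by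
  obtain ⟨⟨hfy, hs0⟩, hopt⟩ := mem_dualOptima_of_eq hy
  obtain ⟨t, ht, hpos⟩ := exists_pos_smul_step (d := -(Aᵀ *ᵥ u)) hs0
    (fun j hj => by simpa using hd j hj)
  have hfeas : Aᵀ *ᵥ (y + t • u) + (s + t • -(Aᵀ *ᵥ u)) = c := by
    rw [mulVec_add, mulVec_smul, ← hfy, smul_neg]
    abel
  have hval : b ⬝ᵥ (y + t • u) = b ⬝ᵥ y + t * (b ⬝ᵥ u) := by
    rw [dotProduct_add, dotProduct_smul, smul_eq_mul]
  have hle : b ⬝ᵥ u ≤ 0 := by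
    have := hopt _ _ ⟨hfeas, hpos⟩
    rw [hval] at this
    by_contra hlt
    nlinarith [mul_pos ht (not_le.mp hlt)]
  refine lt_of_le_of_ne hle fun heq => h0 ?_
  have hmem : (y + t • u, s + t • -(Aᵀ *ᵥ u)) ∈ dualOptima A b c :=
    ⟨⟨hfeas, hpos⟩, fun y' s' h' => by
      simp only [hval, heq, mul_zero, add_zero]; exact hopt y' s' h'⟩
  rw [hy, Set.mem_singleton_iff, Prod.mk.injEq, add_eq_left] at hmem
  exact (smul_eq_zero.mp hmem.1).resolve_left ht.ne'

lemma eq_zero_of_mulVec_eq_zero_of_support (hx : primalOptima A b c = {x}) {d : Fin n → ℝ}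
    (hA : A *ᵥ d = 0) (hd : ∀ j, x j = 0 → d j = 0) : d = 0 := by
  by_contra h0
  have h1 := cost_pos_of_feasible_direction hx hA (fun j hj => (hd j hj).ge) h0
  have h2 := cost_pos_of_feasible_direction hx (d := -d) (by rw [mulVec_neg, hA, neg_zero])
    (fun j hj => by simp [hd j hj]) (neg_ne_zero.mpr h0)
  rw [dotProduct_neg] at h2
  linarith

lemma eq_zero_of_transpose_mulVec_eq_zero (hy : dualOptima A b c = {(y, s)}) {u : Fin m → ℝ}
    (hd : ∀ j, s j = 0 → (Aᵀ *ᵥ u) j = 0) : u = 0 := by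
  by_contra h0
  have h1 := cost_neg_of_dual_feasible_direction hy (fun j hj => (hd j hj).le) h0
  have h2 := cost_neg_of_dual_feasible_direction hy (u := -u)
    (fun j hj => by simp [mulVec_neg, hd j hj]) (neg_ne_zero.mpr h0)
  rw [dotProduct_neg] at h2
  linarith

/-- The map `(y, s) ↦ Aᵀ y + s|_{x = 0}` that parametrizes the dual cost vectors whose slack
vanishes on the support of `x`. -/
def slackMap (A : Matrix (Fin m) (Fin n) ℝ) (x : Fin n → ℝ) :
    ((Fin m → ℝ) × (Fin n → ℝ)) →ₗ[ℝ] (Fin n → ℝ) where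
  toFun p := Aᵀ *ᵥ p.1 + fun j => if 0 < x j then 0 else p.2 j
  map_add' p q := by
    ext j
    by_cases h : 0 < x j <;> simp [h, mulVec_add]
    ring
  map_smul' t p := by
    ext j
    by_cases h : 0 < x j <;> simp [h, mulVec_smul]
    ring

lemma slackMap_apply (p : (Fin m → ℝ) × (Fin n → ℝ)) :
    slackMap A x p = Aᵀ *ᵥ p.1 + fun j => if 0 < x j then 0 else p.2 j := rfl

lemma dotProduct_slackMap (d : Fin n → ℝ) (p : (Fin m → ℝ) × (Fin n → ℝ)) :
    d ⬝ᵥ slackMap A x p = (A *ᵥ d) ⬝ᵥ p.1 + ∑ j, if 0 < x j then 0 else d j * p.2 j := by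
  rw [slackMap_apply, dotProduct_add, dotProduct_comm, transpose_mulVec_dotProduct]
  congr 1
  refine Finset.sum_congr rfl fun j _ => ?_
  split_ifs with h <;> simp [h]

/-- A functional vanishing on the range is given by a `d` in the kernel of `A` supported in the
support of `x`, and uniqueness of the primal solution excludes `d ≠ 0`. -/
lemma slackMap_surjective (hx : primalOptima A b c = {x}) : Function.Surjective (slackMap A x) := by
  classical
  obtain ⟨⟨-, hx0⟩, -⟩ := mem_primalOptima_of_eq hx
  rw [← LinearMap.range_eq_top]
  by_contra hne
  obtain ⟨φ, hφ, hle⟩ := Submodule.exists_le_ker_of_lt_top _ (lt_top_iff_ne_top.mpr hne)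
  obtain ⟨d, hd⟩ := exists_eq_dotProduct φ
  have hz : ∀ p, d ⬝ᵥ slackMap A x p = 0 := fun p => by
    rw [← hd]; exact hle ⟨p, rfl⟩
  have hA : A *ᵥ d = 0 := by
    have := hz (A *ᵥ d, 0)
    rw [dotProduct_slackMap] at this
    simpa using this
  have hsupp : ∀ j, x j = 0 → d j = 0 := by
    intro j hj
    have := hz (0, Pi.single j 1)
    rw [dotProduct_slackMap] at this
    simp only [dotProduct_zero, zero_add] at this
    rw [Finset.sum_eq_single j] at this
    · simpa [hj] using this
    · intro k _ hk
      simp [hk]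
    · simp
  have hd0 := eq_zero_of_mulVec_eq_zero_of_support hx hA hsupp
  exact hφ (LinearMap.ext fun v => by rw [hd, hd0]; simp)

lemma eq_zero_of_forall_lt_mul_add {a p K : ℝ} (h : ∀ t : ℝ, a < t * p + K) : p = 0 := by
  by_contra hp
  have := h ((a - K) / p)
  rw [div_mul_cancel₀ _ hp] at this
  linarith

lemma nonneg_of_forall_lt_mul_add {a p K : ℝ} (h : ∀ t : ℝ, 0 ≤ t → a < t * p + K) : 0 ≤ p := by
  by_contra! hp
  have h1 := h (|a - K| / (-p)) (div_nonneg (abs_nonneg _) (by linarith))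
  rw [div_neg, neg_mul, div_mul_cancel₀ _ hp.ne] at h1
  linarith [neg_abs_le (a - K)]

/-- The vectors `Aᵀ y + s` with `s` vanishing on the support of `x` and positive elsewhere form an
open convex set. If `c` were outside, a separating functional would be a nonzero feasible
direction at `x` along which the cost does not increase. -/
lemma exists_strictly_complementary (hx : primalOptima A b c = {x}) :
    ∃ y' s', Aᵀ *ᵥ y' + s' = c ∧ (∀ j, 0 < x j → s' j = 0) ∧ ∀ j, ¬ 0 < x j → 0 < s' j := by
  classical
  obtain ⟨⟨-, hx0⟩, -⟩ := mem_primalOptima_of_eq hx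
  set U : Set ((Fin m → ℝ) × (Fin n → ℝ)) := {p | ∀ j, 0 < p.2 j} with hU
  have hUo : IsOpen U := by
    rw [hU, Set.ofPred_forall]
    exact isOpen_iInter_of_finite fun j => isOpen_lt (by fun_prop) (by fun_prop)
  have hUc : Convex ℝ U := by
    intro p hp q hq α β hα hβ hαβ j
    have h1 := hp j
    have h2 := hq j
    rcases hα.eq_or_lt with rfl | hα
    · have : β = 1 := by linarith
      simpa [this] using h2
    · have := mul_pos hα h1
      have := mul_nonneg hβ h2.le
      simp only [Prod.snd_add, Prod.smul_snd, Pi.add_apply, Pi.smul_apply, smul_eq_mul]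
      linarith
  have hSo : IsOpen (slackMap A x '' U) :=
    (slackMap A x).isOpenMap_of_finiteDimensional (slackMap_surjective hx) U hUo
  by_cases hc : c ∈ slackMap A x '' U
  · obtain ⟨p, hp, hpc⟩ := hc
    exact ⟨p.1, fun j => if 0 < x j then 0 else p.2 j, hpc, fun j hj => by simp [hj],
      fun j hj => by simpa [hj] using hp j⟩
  exfalso
  obtain ⟨f, hf⟩ := geometric_hahn_banach_point_open (hUc.linear_image (slackMap A x)) hSo hc
  obtain ⟨d, hd⟩ := exists_eq_dotProduct f.toLinearMap
  have hlt : ∀ (y' : Fin m → ℝ) (s' : Fin n → ℝ), (∀ j, 0 < s' j) →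
      c ⬝ᵥ d < (A *ᵥ d) ⬝ᵥ y' + ∑ j, if 0 < x j then 0 else d j * s' j := by
    intro y' s' hs'
    have := hf _ ⟨(y', s'), hs', rfl⟩
    rwa [← f.coe_coe, hd, hd, dotProduct_slackMap, dotProduct_comm d c] at this
  have hA : A *ᵥ d = 0 := by
    rw [← dotProduct_self_eq_zero]
    refine eq_zero_of_forall_lt_mul_add (a := c ⬝ᵥ d)
      (K := ∑ j, if 0 < x j then 0 else d j * 1) fun t => ?_
    simpa using hlt (t • (A *ᵥ d)) 1 (fun _ => one_pos)
  simp only [hA, zero_dotProduct, zero_add] at hlt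
  have hsupp : ∀ j, x j = 0 → 0 ≤ d j := by
    intro j hj
    refine nonneg_of_forall_lt_mul_add (a := c ⬝ᵥ d)
      (K := ∑ j, if 0 < x j then 0 else d j * 1) fun t ht => ?_
    refine (hlt 0 (1 + Pi.single j t) fun k => ?_).trans_eq ?_
    · have : 0 ≤ (Pi.single j t : Fin n → ℝ) k := by
        rw [Pi.single_apply]; split_ifs <;> simp [ht]
      simp only [Pi.add_apply, Pi.one_apply]
      linarith
    · have hsplit : ∀ k, (if 0 < x k then 0 else d k * (1 + Pi.single j t : Fin n → ℝ) k)
          = (if k = j then t * d j else 0) + if 0 < x k then 0 else d k * 1 := by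
        intro k
        by_cases hk : k = j
        · subst hk; simp [hj]; ring
        · simp [hk]
      rw [Finset.sum_congr rfl fun k _ => hsplit k, Finset.sum_add_distrib]
      simp
  have hcd : c ⬝ᵥ d ≤ 0 := by
    set K := ∑ j, if 0 < x j then 0 else d j * 1 with hK
    have hK' : ∀ t : ℝ, 0 < t → c ⬝ᵥ d < t * K := by
      intro t ht
      refine (hlt 0 (fun _ => t) fun _ => ht).trans_eq ?_
      rw [hK, Finset.mul_sum]
      refine Finset.sum_congr rfl fun j _ => ?_
      split_ifs <;> ring
    have hlim : Tendsto (fun t : ℝ => t * K) (𝓝[>] 0) (𝓝 (0 * K)) :=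
      (Continuous.tendsto (by fun_prop) _).mono_left nhdsWithin_le_nhds
    rw [zero_mul] at hlim
    exact ge_of_tendsto hlim (by filter_upwards [self_mem_nhdsWithin] with t ht using (hK' t ht).le)
  have hd0 : d ≠ 0 := by
    rintro rfl
    simpa using hlt 0 1 (fun _ => one_pos)
  exact absurd (cost_pos_of_feasible_direction hx hA hsupp hd0) (not_lt.mpr hcd)

/-- The strictly complementary dual point is optimal by weak duality, hence it is `(y, s)`. -/
lemma strict_complementarity (hx : primalOptima A b c = {x}) (hy : dualOptima A b c = {(y, s)}) :
    (∀ j, 0 < x j → s j = 0) ∧ ∀ j, ¬ 0 < x j → 0 < s j := by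
  obtain ⟨⟨hfx, hx0⟩, -⟩ := mem_primalOptima_of_eq hx
  obtain ⟨y', s', hfeas, hz, hp⟩ := exists_strictly_complementary hx
  have hval : ∀ y'' s'', Aᵀ *ᵥ y'' + s'' = c → b ⬝ᵥ y'' = c ⬝ᵥ x - s'' ⬝ᵥ x := by
    intro y'' s'' h
    rw [← h, ← hfx, ← transpose_mulVec_dotProduct, add_dotProduct]
    ring
  have hsx : s' ⬝ᵥ x = 0 := Finset.sum_eq_zero fun j _ => by
    rcases (hx0 j).eq_or_lt with h | h
    · simp [← h]
    · simp [hz j h]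
  have hmem : (y', s') ∈ dualOptima A b c := by
    refine ⟨⟨hfeas, fun j => ?_⟩, fun y'' s'' h => ?_⟩
    · by_cases h : 0 < x j
      · exact (hz j h).ge
      · exact (hp j h).le
    · rw [hval _ _ h.1, hval _ _ hfeas, hsx]
      have : 0 ≤ s'' ⬝ᵥ x := dotProduct_nonneg_of_nonneg h.2 hx0
      linarith
  rw [hy, Set.mem_singleton_iff, Prod.mk.injEq] at hmem
  exact hmem.2 ▸ ⟨hz, hp⟩

lemma mem_basisSet {j : Fin n} : j ∈ basisSet x ↔ 0 < x j := by simp [basisSet]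

/-- The map `y ↦ (Aᵀ y)|_Θ` is onto by uniqueness of the primal solution and one-to-one by
uniqueness of the dual solution. -/
lemma card_basisSet (hx : primalOptima A b c = {x}) (hy : dualOptima A b c = {(y, s)}) :
    (basisSet x).card = m := by
  classical
  obtain ⟨hsc, hsp⟩ := strict_complementarity hx hy
  let g : (Fin m → ℝ) →ₗ[ℝ] (basisSet x → ℝ) :=
    (A.submatrix id (Subtype.val : basisSet x → Fin n))ᵀ.mulVecLin
  have hg : ∀ u j, g u j = (Aᵀ *ᵥ u) j := fun u j => rfl
  have hinj : Function.Injective g := by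
    rw [← LinearMap.ker_eq_bot, LinearMap.ker_eq_bot']
    intro u hu
    refine eq_zero_of_transpose_mulVec_eq_zero hy fun j hj => ?_
    have hxj : 0 < x j := by
      by_contra h
      exact (hsp j h).ne' hj
    rw [← hg u ⟨j, mem_basisSet.mpr hxj⟩, hu]
    rfl
  have hsurj : Function.Surjective g := by
    intro t
    obtain ⟨p, hp⟩ := slackMap_surjective hx (fun j => if h : j ∈ basisSet x then t ⟨j, h⟩ else 0)
    refine ⟨p.1, funext fun j => ?_⟩
    have := congrFun hp j
    simpa [slackMap_apply, mem_basisSet.mp j.2, hg] using this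
  simpa using (LinearEquiv.ofBijective g ⟨hinj, hsurj⟩).finrank_eq.symm

lemma basisIdx_mem (h : (basisSet x).card = m) (i : Fin m) : basisIdx x h i ∈ basisSet x :=
  Finset.orderEmbOfFin_mem _ _ _

lemma exists_basisIdx_eq (h : (basisSet x).card = m) {j : Fin n} (hj : j ∈ basisSet x) :
    ∃ i, basisIdx x h i = j := by
  have : j ∈ Set.range ((basisSet x).orderEmbOfFin h) := by
    rw [Finset.range_orderEmbOfFin]; exact hj
  exact this

lemma isUnit_det_basisMat (hx : primalOptima A b c = {x}) (hy : dualOptima A b c = {(y, s)})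
    (h : (basisSet x).card = m) : IsUnit (basisMat A x h).det := by
  obtain ⟨hsc, hsp⟩ := strict_complementarity hx hy
  rw [← det_transpose, ← Matrix.isUnit_iff_isUnit_det, ← mulVec_injective_iff_isUnit]
  change Function.Injective (basisMat A x h)ᵀ.mulVecLin
  rw [← LinearMap.ker_eq_bot, LinearMap.ker_eq_bot']
  intro u hu
  refine eq_zero_of_transpose_mulVec_eq_zero hy fun j hj => ?_
  have hxj : 0 < x j := by
    by_contra h
    exact (hsp j h).ne' hj
  obtain ⟨i, rfl⟩ := exists_basisIdx_eq h (mem_basisSet.mpr hxj)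
  exact congrFun hu i

end LinearProgram

/-! ### One step, averages and the normalized gap -/

section PrimalDual

variable {m n : ℕ} {A : Matrix (Fin m) (Fin n) ℝ} {b : Fin m → ℝ} {c : Fin n → ℝ} {τ σ : ℝ}

/-- The squared norm `‖x‖² / τ + ‖y‖² / σ`. -/
def weightedSq (τ σ : ℝ) (z : Iterate m n) : ℝ := (1 / τ) * (z.1 ⬝ᵥ z.1) + (1 / σ) * (z.2 ⬝ᵥ z.2)

/-- The quadratic form `‖x‖² / τ + 2 (A x) ⬝ y + ‖y‖² / σ` in which one step of the method is
firmly nonexpansive. Its mixed term has the opposite sign to the one of `mNorm`. -/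
def pdhgSq (A : Matrix (Fin m) (Fin n) ℝ) (τ σ : ℝ) (z : Iterate m n) : ℝ :=
  weightedSq τ σ z + 2 * ((A *ᵥ z.1) ⬝ᵥ z.2)

/-- The duality gap `L(x, ŷ) - L(x̂, y)` at `(x, y)` against `(x̂, ŷ)`. -/
def gap (A : Matrix (Fin m) (Fin n) ℝ) (b : Fin m → ℝ) (c : Fin n → ℝ) (z z' : Iterate m n) : ℝ :=
  lagrangian A b c z.1 z'.2 - lagrangian A b c z'.1 z.2

/-- The step sizes are small enough: the mixed term is at most half of the diagonal part. -/
def StepBound (A : Matrix (Fin m) (Fin n) ℝ) (τ σ : ℝ) : Prop :=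
  0 < τ ∧ 0 < σ ∧ ∀ z : Iterate m n, |2 * ((A *ᵥ z.1) ⬝ᵥ z.2)| ≤ weightedSq τ σ z / 2

lemma self_dotProduct_nonneg {ι : Type*} [Fintype ι] (v : ι → ℝ) : 0 ≤ v ⬝ᵥ v := by
  rw [← euc_sq]; positivity

lemma weightedSq_nonneg (hτ : 0 < τ) (hσ : 0 < σ) (z : Iterate m n) : 0 ≤ weightedSq τ σ z := by
  have h1 := self_dotProduct_nonneg z.1
  have h2 := self_dotProduct_nonneg z.2
  unfold weightedSq
  positivity

lemma eq_zero_of_weightedSq_nonpos (hτ : 0 < τ) (hσ : 0 < σ) {z : Iterate m n}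
    (h : weightedSq τ σ z ≤ 0) : z = 0 := by
  have h1 := mul_nonneg (one_div_pos.mpr hτ).le (self_dotProduct_nonneg z.1)
  have h2 := mul_nonneg (one_div_pos.mpr hσ).le (self_dotProduct_nonneg z.2)
  unfold weightedSq at h
  have h3 : (1 / τ) * (z.1 ⬝ᵥ z.1) = 0 := by linarith
  have h4 : (1 / σ) * (z.2 ⬝ᵥ z.2) = 0 := by linarith
  rw [mul_eq_zero, dotProduct_self_eq_zero] at h3 h4
  exact Prod.ext (h3.resolve_left (one_div_pos.mpr hτ).ne')
    (h4.resolve_left (one_div_pos.mpr hσ).ne')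

lemma mNorm_sq (hS : StepBound A τ σ) (z : Iterate m n) :
    mNorm A τ σ z ^ 2 = weightedSq τ σ z - 2 * ((A *ᵥ z.1) ⬝ᵥ z.2) := by
  have hform : Sum.elim z.1 z.2 ⬝ᵥ (normMat A τ σ *ᵥ Sum.elim z.1 z.2)
      = weightedSq τ σ z - 2 * ((A *ᵥ z.1) ⬝ᵥ z.2) := by
    rw [normMat, fromBlocks_mulVec, sumElim_dotProduct_sumElim]
    simp only [Sum.elim_comp_inl, Sum.elim_comp_inr, smul_mulVec, one_mulVec, neg_mulVec,
      dotProduct_add, dotProduct_neg, dotProduct_smul, smul_eq_mul, weightedSq]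
    rw [dotProduct_comm z.1 (Aᵀ *ᵥ z.2), transpose_mulVec_dotProduct, dotProduct_comm z.2]
    ring
  rw [mNorm, hform, Real.sq_sqrt]
  have h1 := le_abs_self (2 * ((A *ᵥ z.1) ⬝ᵥ z.2))
  have h2 := weightedSq_nonneg hS.1 hS.2.1 z
  linarith [hS.2.2 z]

lemma mNorm_nonneg (z : Iterate m n) : 0 ≤ mNorm A τ σ z := Real.sqrt_nonneg _

lemma mNorm_sub_self (z : Iterate m n) : mNorm A τ σ (z - z) = 0 := by simp [mNorm]

lemma mNorm_sq_le (hS : StepBound A τ σ) (z : Iterate m n) :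
    mNorm A τ σ z ^ 2 ≤ 3 * pdhgSq A τ σ z := by
  rw [mNorm_sq hS, pdhgSq]
  have h1 := abs_le.mp (hS.2.2 z)
  linarith

lemma pdhgSq_le_mNorm_sq (hS : StepBound A τ σ) (z : Iterate m n) :
    pdhgSq A τ σ z ≤ 3 * mNorm A τ σ z ^ 2 := by
  rw [mNorm_sq hS, pdhgSq]
  have h1 := abs_le.mp (hS.2.2 z)
  linarith

lemma pdhgSq_le_weightedSq (hS : StepBound A τ σ) (z : Iterate m n) :
    pdhgSq A τ σ z ≤ 3 / 2 * weightedSq τ σ z := by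
  rw [pdhgSq]
  have h1 := abs_le.mp (hS.2.2 z)
  linarith

lemma weightedSq_le_pdhgSq (hS : StepBound A τ σ) (z : Iterate m n) :
    weightedSq τ σ z ≤ 2 * pdhgSq A τ σ z := by
  rw [pdhgSq]
  have h1 := abs_le.mp (hS.2.2 z)
  linarith

lemma pdhgSq_nonneg (hS : StepBound A τ σ) (z : Iterate m n) : 0 ≤ pdhgSq A τ σ z := by
  linarith [weightedSq_le_pdhgSq hS z, weightedSq_nonneg hS.1 hS.2.1 z]

lemma weightedSq_le_mNorm_sq (hS : StepBound A τ σ) (z : Iterate m n) :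
    weightedSq τ σ z ≤ 2 * mNorm A τ σ z ^ 2 := by
  rw [mNorm_sq hS]
  have h1 := abs_le.mp (hS.2.2 z)
  linarith

lemma pdhgSq_smul_add_smul (α β : ℝ) (u v : Iterate m n) (h : α + β = 1) :
    pdhgSq A τ σ (α • u + β • v)
      = α * pdhgSq A τ σ u + β * pdhgSq A τ σ v - α * β * pdhgSq A τ σ (u - v) := by
  obtain rfl : β = 1 - α := by linarith
  simp only [pdhgSq, weightedSq, Prod.fst_add, Prod.snd_add, Prod.smul_fst, Prod.smul_snd,
    Prod.fst_sub, Prod.snd_sub, mulVec_add, mulVec_sub, mulVec_smul, dotProduct_add,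
    add_dotProduct, dotProduct_sub, sub_dotProduct, dotProduct_smul, smul_dotProduct, smul_eq_mul]
  rw [dotProduct_comm v.1 u.1, dotProduct_comm v.2 u.2]
  ring

lemma pdhgSq_neg (u : Iterate m n) : pdhgSq A τ σ (-u) = pdhgSq A τ σ u := by
  simp [pdhgSq, weightedSq, mulVec_neg]

lemma pdhgSq_sub_comm (u v : Iterate m n) : pdhgSq A τ σ (u - v) = pdhgSq A τ σ (v - u) := by
  rw [← pdhgSq_neg, neg_sub]

lemma pdhgSq_add_le (hS : StepBound A τ σ) (u v : Iterate m n) :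
    pdhgSq A τ σ (u + v) ≤ 2 * pdhgSq A τ σ u + 2 * pdhgSq A τ σ v := by
  have h : pdhgSq A τ σ (u + v) = 2 * pdhgSq A τ σ u + 2 * pdhgSq A τ σ v
      - pdhgSq A τ σ (u - v) := by
    simp only [pdhgSq, weightedSq, Prod.fst_add, Prod.snd_add, Prod.fst_sub, Prod.snd_sub,
      mulVec_add, mulVec_sub, dotProduct_add, add_dotProduct, dotProduct_sub, sub_dotProduct]
    ring
  linarith [pdhgSq_nonneg hS (u - v)]

lemma mNorm_sq_add_le (hS : StepBound A τ σ) (u v : Iterate m n) :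
    mNorm A τ σ (u + v) ^ 2 ≤ 2 * mNorm A τ σ u ^ 2 + 2 * mNorm A τ σ v ^ 2 := by
  have h : mNorm A τ σ (u + v) ^ 2 = 2 * mNorm A τ σ u ^ 2 + 2 * mNorm A τ σ v ^ 2
      - mNorm A τ σ (u - v) ^ 2 := by
    simp only [mNorm_sq hS, weightedSq, Prod.fst_add, Prod.snd_add, Prod.fst_sub, Prod.snd_sub,
      mulVec_add, mulVec_sub, dotProduct_add, add_dotProduct, dotProduct_sub, sub_dotProduct]
    ring
  linarith [sq_nonneg (mNorm A τ σ (u - v))]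

lemma convex_pdhgSq_le (hS : StepBound A τ σ) (z : Iterate m n) (R : ℝ) :
    Convex ℝ {u : Iterate m n | pdhgSq A τ σ (u - z) ≤ R} := by
  intro u hu v hv α β hα hβ hαβ
  have h : α • u + β • v - z = α • (u - z) + β • (v - z) := by
    have : z = (α + β) • z := by rw [hαβ, one_smul]
    conv_lhs => rw [this]
    module
  simp only [Set.mem_ofPred_eq] at hu hv ⊢
  rw [h, pdhgSq_smul_add_smul _ _ _ _ hαβ]
  have h1 := mul_le_mul_of_nonneg_left hu hα
  have h2 := mul_le_mul_of_nonneg_left hv hβ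
  have h3 := mul_nonneg (mul_nonneg hα hβ) (pdhgSq_nonneg hS (u - z - (v - z)))
  have h4 : α * R + β * R = R := by rw [← add_mul, hαβ, one_mul]
  linarith

lemma gap_self (z : Iterate m n) : gap A b c z z = 0 := sub_self _

/-- The gap in terms of the two gradients of the Lagrangian at `z`. -/
lemma gap_eq (z z' : Iterate m n) :
    gap A b c z z' = (c - Aᵀ *ᵥ z.2) ⬝ᵥ (z.1 - z'.1) + (b - A *ᵥ z.1) ⬝ᵥ (z'.2 - z.2) := by
  simp only [gap, lagrangian, sub_dotProduct, dotProduct_sub, transpose_mulVec_dotProduct]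
  ring

lemma onePDHG_fst_nonneg (z : Iterate m n) : 0 ≤ (onePDHG A b c τ σ z).1 := le_sup_right

/-- The projection inequality for the primal update and the definition of the dual update turn the
gap at the new point into a difference of squared distances. -/
lemma gap_onePDHG_le (hτ : 0 < τ) (hσ : 0 < σ) (z z' : Iterate m n) (hz' : 0 ≤ z'.1) :
    2 * gap A b c (onePDHG A b c τ σ z) z' ≤ pdhgSq A τ σ (z - z')
      - pdhgSq A τ σ (onePDHG A b c τ σ z - z') - pdhgSq A τ σ (onePDHG A b c τ σ z - z) := by
  set w := onePDHG A b c τ σ z with hw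
  have hx : w.1 = (z.1 - τ • (c - Aᵀ *ᵥ z.2)) ⊔ 0 := rfl
  have hy : b = (1 / σ) • (w.2 - z.2) + A *ᵥ ((2 : ℝ) • w.1 - z.1) := by
    have h2 : w.2 - z.2 = σ • (b - A *ᵥ ((2 : ℝ) • w.1 - z.1)) := add_sub_cancel_left _ _
    rw [h2, smul_smul, one_div_mul_cancel hσ.ne', one_smul, sub_add_cancel]
  have hproj : 0 ≤ (c - Aᵀ *ᵥ z.2 + (1 / τ) • (w.1 - z.1)) ⬝ᵥ (z'.1 - w.1) := by
    refine Finset.sum_nonneg fun i _ => ?_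
    have hxi : w.1 i = max (z.1 i - τ * (c - Aᵀ *ᵥ z.2) i) 0 := by rw [hx]; rfl
    set q := (c - Aᵀ *ᵥ z.2) i with hq
    have hz'i : 0 ≤ z'.1 i := hz' i
    simp only [Pi.add_apply, Pi.smul_apply, Pi.sub_apply z'.1, Pi.sub_apply w.1, smul_eq_mul,
      ← hq]
    rcases le_total (z.1 i - τ * q) 0 with h | h
    · rw [max_eq_right h] at hxi
      rw [hxi, sub_zero]
      refine mul_nonneg ?_ hz'i
      have : 1 / τ * (τ * q - z.1 i) = q + 1 / τ * (0 - z.1 i) := by field_simp; ring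
      rw [← this]
      exact mul_nonneg (one_div_pos.mpr hτ).le (by linarith)
    · rw [max_eq_left h] at hxi
      have : q + 1 / τ * (w.1 i - z.1 i) = 0 := by rw [hxi]; field_simp; ring
      rw [this, zero_mul]
  have hid : pdhgSq A τ σ (z - z') - pdhgSq A τ σ (w - z') - pdhgSq A τ σ (w - z)
      - 2 * gap A b c w z' = 2 * ((c - Aᵀ *ᵥ z.2 + (1 / τ) • (w.1 - z.1)) ⬝ᵥ (z'.1 - w.1)) := by
    clear_value w
    subst hy
    simp only [gap_eq, pdhgSq, weightedSq, Prod.fst_sub, Prod.snd_sub, mulVec_sub, mulVec_smul,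
      dotProduct_sub, sub_dotProduct, smul_dotProduct, smul_eq_mul,
      add_dotProduct, transpose_mulVec_dotProduct]
    rw [dotProduct_comm z'.1 z.1, dotProduct_comm z'.2 z.2, dotProduct_comm w.1 z.1,
      dotProduct_comm w.2 z.2, dotProduct_comm w.1 z'.1, dotProduct_comm w.2 z'.2]
    ring
  linarith

lemma isSaddlePoint_gap_nonneg {zs : Iterate m n} (hzs : IsSaddlePoint A b c zs) (z : Iterate m n)
    (hz : 0 ≤ z.1) : 0 ≤ gap A b c z zs := by
  have h1 := hzs.2.1 z.2
  have h2 := hzs.2.2 z.1 hz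
  unfold gap
  linarith

lemma gap_nonpos_of_isSaddlePoint {zs : Iterate m n} (hzs : IsSaddlePoint A b c zs)
    (z : Iterate m n) (hz : 0 ≤ z.1) : gap A b c zs z ≤ 0 := by
  have h1 := hzs.2.1 z.2
  have h2 := hzs.2.2 z.1 hz
  unfold gap
  linarith

lemma isSaddlePoint_of_gap_nonpos {z : Iterate m n} (hz0 : 0 ≤ z.1)
    (h : ∀ z' : Iterate m n, 0 ≤ z'.1 → gap A b c z z' ≤ 0) : IsSaddlePoint A b c z := by
  refine ⟨hz0, fun y' => ?_, fun x' hx' => ?_⟩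
  · simpa [gap] using h (z.1, y') hz0
  · simpa [gap] using h (x', z.2) hx'

/-- A fixed point of the step is a saddle point. -/
lemma isSaddlePoint_of_onePDHG_eq (hτ : 0 < τ) (hσ : 0 < σ) {z : Iterate m n}
    (h : onePDHG A b c τ σ z = z) : IsSaddlePoint A b c z := by
  refine isSaddlePoint_of_gap_nonpos (h ▸ onePDHG_fst_nonneg z) fun z' hz' => ?_
  have := gap_onePDHG_le (b := b) (c := c) (A := A) hτ hσ z z' hz'
  rw [h, sub_self z] at this
  have h0 : pdhgSq A τ σ (0 : Iterate m n) = 0 := by simp [pdhgSq, weightedSq]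
  rw [h0] at this
  linarith

lemma innerIter_succ (z : Iterate m n) (k : ℕ) :
    innerIter A b c τ σ z (k + 1) = onePDHG A b c τ σ (innerIter A b c τ σ z k) :=
  Function.iterate_succ_apply' _ _ _

lemma innerIter_fst_nonneg (z : Iterate m n) {k : ℕ} (hk : 1 ≤ k) :
    0 ≤ (innerIter A b c τ σ z k).1 := by
  obtain ⟨k, rfl⟩ := Nat.exists_eq_add_of_le' hk
  rw [innerIter_succ]
  exact onePDHG_fst_nonneg _

lemma sum_gap_innerIter_le (hS : StepBound A τ σ) (z z' : Iterate m n) (hz' : 0 ≤ z'.1) (k : ℕ) :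
    2 * ∑ i ∈ Finset.Icc 1 k, gap A b c (innerIter A b c τ σ z i) z'
      ≤ pdhgSq A τ σ (z - z') - pdhgSq A τ σ (innerIter A b c τ σ z k - z') := by
  induction k with
  | zero => simp [innerIter]
  | succ k ih =>
    rw [Finset.sum_Icc_succ_top (by omega), innerIter_succ]
    have h1 := gap_onePDHG_le (A := A) (b := b) (c := c) hS.1 hS.2.1
      (innerIter A b c τ σ z k) z' hz'
    have h2 := pdhgSq_nonneg hS
      (onePDHG A b c τ σ (innerIter A b c τ σ z k) - innerIter A b c τ σ z k)
    linarith

lemma innerAvg_fst_nonneg (z : Iterate m n) (k : ℕ) : 0 ≤ (innerAvg A b c τ σ z k).1 := by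
  rw [innerAvg, Prod.smul_fst, Prod.fst_sum]
  exact smul_nonneg (by positivity)
    (Finset.sum_nonneg fun i hi => innerIter_fst_nonneg z (Finset.mem_Icc.mp hi).1)

lemma innerAvg_eq_sum (z : Iterate m n) (k : ℕ) :
    innerAvg A b c τ σ z k
      = ∑ i ∈ Finset.Icc 1 k, (1 / (k : ℝ)) • innerIter A b c τ σ z i := by
  rw [innerAvg, Finset.smul_sum]

/-- For fixed `z'`, the gap is an affine function of its first argument, hence it commutes with
averaging. -/
lemma gap_innerAvg (z z' : Iterate m n) {k : ℕ} (hk : 1 ≤ k) :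
    (k : ℝ) * gap A b c (innerAvg A b c τ σ z k) z'
      = ∑ i ∈ Finset.Icc 1 k, gap A b c (innerIter A b c τ σ z i) z' := by
  have hk0 : (k : ℝ) ≠ 0 := by positivity
  have haff : ∀ w : Iterate m n, gap A b c w z'
      = ((c - Aᵀ *ᵥ z'.2) ⬝ᵥ w.1 - (b - A *ᵥ z'.1) ⬝ᵥ w.2) + (b ⬝ᵥ z'.2 - c ⬝ᵥ z'.1) := by
    intro w
    simp only [gap, lagrangian, sub_dotProduct, transpose_mulVec_dotProduct]
    ring
  have hsum : (k : ℝ) • innerAvg A b c τ σ z k = ∑ i ∈ Finset.Icc 1 k, innerIter A b c τ σ z i := by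
    rw [innerAvg, smul_smul, mul_one_div_cancel hk0, one_smul]
  have h1 := congrArg Prod.fst hsum
  have h2 := congrArg Prod.snd hsum
  rw [Prod.smul_fst, Prod.fst_sum] at h1
  rw [Prod.smul_snd, Prod.snd_sum] at h2
  simp only [haff]
  rw [Finset.sum_add_distrib, Finset.sum_sub_distrib, ← dotProduct_sum, ← dotProduct_sum, ← h1,
    ← h2, dotProduct_smul, dotProduct_smul, Finset.sum_const, Nat.card_Icc, smul_eq_mul,
    smul_eq_mul, nsmul_eq_mul]
  simp only [Nat.add_sub_cancel]
  ring

lemma gap_innerAvg_le (hS : StepBound A τ σ) (z z' : Iterate m n) (hz' : 0 ≤ z'.1) {k : ℕ}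
    (hk : 1 ≤ k) :
    2 * k * gap A b c (innerAvg A b c τ σ z k) z' ≤ pdhgSq A τ σ (z - z') := by
  rw [mul_assoc, gap_innerAvg z z' hk]
  linarith [sum_gap_innerIter_le (A := A) (b := b) (c := c) hS z z' hz' k,
    pdhgSq_nonneg hS (innerIter A b c τ σ z k - z')]

section Saddle

variable {zs : Iterate m n}

lemma pdhgSq_onePDHG_le (hS : StepBound A τ σ) (hzs : IsSaddlePoint A b c zs) (z : Iterate m n) :
    pdhgSq A τ σ (onePDHG A b c τ σ z - zs) + pdhgSq A τ σ (onePDHG A b c τ σ z - z)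
      ≤ pdhgSq A τ σ (z - zs) := by
  have h1 := gap_onePDHG_le (A := A) (b := b) (c := c) hS.1 hS.2.1 z zs hzs.1
  have h2 := isSaddlePoint_gap_nonneg hzs _ (onePDHG_fst_nonneg (A := A) (b := b) (c := c)
    (τ := τ) (σ := σ) z)
  linarith

lemma pdhgSq_innerIter_le (hS : StepBound A τ σ) (hzs : IsSaddlePoint A b c zs) (z : Iterate m n)
    {k : ℕ} (hk : 1 ≤ k) :
    pdhgSq A τ σ (innerIter A b c τ σ z k - zs) ≤ pdhgSq A τ σ (onePDHG A b c τ σ z - zs) := by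
  induction k, hk using Nat.le_induction with
  | base => exact le_of_eq rfl
  | succ k hk ih =>
    rw [innerIter_succ]
    linarith [pdhgSq_onePDHG_le hS hzs (innerIter A b c τ σ z k),
      pdhgSq_nonneg hS (onePDHG A b c τ σ (innerIter A b c τ σ z k) - innerIter A b c τ σ z k)]

lemma pdhgSq_innerAvg_le (hS : StepBound A τ σ) (hzs : IsSaddlePoint A b c zs) (z : Iterate m n)
    {k : ℕ} (hk : 1 ≤ k) :
    pdhgSq A τ σ (innerAvg A b c τ σ z k - zs) ≤ pdhgSq A τ σ (onePDHG A b c τ σ z - zs) := by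
  rw [innerAvg_eq_sum]
  refine (convex_pdhgSq_le hS zs _).sum_mem (fun i _ => by positivity) ?_ fun i hi => ?_
  · have : (k : ℝ) ≠ 0 := by positivity
    simp [this]
  · exact pdhgSq_innerIter_le hS hzs z (Finset.mem_Icc.mp hi).1

lemma pdhgSq_innerAvg_le_start (hS : StepBound A τ σ) (hzs : IsSaddlePoint A b c zs)
    (z : Iterate m n) {k : ℕ} (hk : 1 ≤ k) :
    pdhgSq A τ σ (innerAvg A b c τ σ z k - zs) ≤ pdhgSq A τ σ (z - zs) := by
  linarith [pdhgSq_innerAvg_le hS hzs z hk, pdhgSq_onePDHG_le hS hzs z,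
    pdhgSq_nonneg hS (onePDHG A b c τ σ z - z)]

/-- The first step away from a non-saddle point strictly decreases the distance to a saddle point,
so the average cannot return to the starting point. In particular the radius in the restart
condition is never `0`, where `normGap` would have the value `0`. -/
lemma innerAvg_ne (hS : StepBound A τ σ) (hzs : IsSaddlePoint A b c zs) {z : Iterate m n}
    (hz : ¬ IsSaddlePoint A b c z) {k : ℕ} (hk : 1 ≤ k) : innerAvg A b c τ σ z k ≠ z := by
  intro h
  have h1 := pdhgSq_innerAvg_le hS hzs z hk
  have h2 := pdhgSq_onePDHG_le hS hzs z
  rw [h] at h1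
  refine hz (isSaddlePoint_of_onePDHG_eq hS.1 hS.2.1 (sub_eq_zero.mp ?_))
  refine eq_zero_of_weightedSq_nonpos hS.1 hS.2.1 ?_
  linarith [weightedSq_le_pdhgSq hS (onePDHG A b c τ σ z - z)]

lemma mNorm_sub_pos (hS : StepBound A τ σ) {z z' : Iterate m n} (h : z ≠ z') :
    0 < mNorm A τ σ (z - z') := by
  refine lt_of_le_of_ne (mNorm_nonneg _) fun h0 => h (sub_eq_zero.mp ?_)
  refine eq_zero_of_weightedSq_nonpos hS.1 hS.2.1 ?_
  have := weightedSq_le_mNorm_sq hS (z - z')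
  rw [← h0] at this
  linarith

lemma mNorm_innerAvg_sub_sq_le (hS : StepBound A τ σ) (hzs : IsSaddlePoint A b c zs)
    (z : Iterate m n) {k : ℕ} (hk : 1 ≤ k) :
    mNorm A τ σ (innerAvg A b c τ σ z k - z) ^ 2 ≤ 12 * pdhgSq A τ σ (z - zs) := by
  have h1 := mNorm_sq_le hS (innerAvg A b c τ σ z k - z)
  have h2 := pdhgSq_add_le hS (innerAvg A b c τ σ z k - zs) (zs - z)
  rw [sub_add_sub_cancel, pdhgSq_sub_comm zs z] at h2
  linarith [pdhgSq_innerAvg_le_start hS hzs z hk]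

end Saddle

lemma bddAbove_gap_image (hS : StepBound A τ σ) (r : ℝ) (z : Iterate m n) :
    BddAbove ((fun z' : Iterate m n => lagrangian A b c z.1 z'.2 - lagrangian A b c z'.1 z.2) ''
      {z' : Iterate m n | 0 ≤ z'.1 ∧ mNorm A τ σ (z' - z) ≤ r}) := by
  have hτ := hS.1
  have hσ := hS.2.1
  refine ⟨euc (c - Aᵀ *ᵥ z.2) * (2 * τ * r ^ 2 + 1) + euc (b - A *ᵥ z.1) * (2 * σ * r ^ 2 + 1), ?_⟩
  rintro _ ⟨z', ⟨-, hr⟩, rfl⟩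
  change gap A b c z z' ≤ _
  rw [gap_eq]
  have hW : weightedSq τ σ (z' - z) ≤ 2 * r ^ 2 :=
    (weightedSq_le_mNorm_sq hS _).trans
      (mul_le_mul_of_nonneg_left (pow_le_pow_left₀ (mNorm_nonneg _) hr 2) two_pos.le)
  rw [weightedSq, ← euc_sq, ← euc_sq] at hW
  have e1 : 0 ≤ 1 / τ * euc (z' - z).1 ^ 2 := by positivity
  have e2 : 0 ≤ 1 / σ * euc (z' - z).2 ^ 2 := by positivity
  have b1 : euc (z' - z).1 ^ 2 ≤ 2 * τ * r ^ 2 := by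
    have : 1 / τ * euc (z' - z).1 ^ 2 ≤ 2 * r ^ 2 := by linarith
    rw [one_div, inv_mul_le_iff₀ hτ] at this
    linarith
  have b2 : euc (z' - z).2 ^ 2 ≤ 2 * σ * r ^ 2 := by
    have : 1 / σ * euc (z' - z).2 ^ 2 ≤ 2 * r ^ 2 := by linarith
    rw [one_div, inv_mul_le_iff₀ hσ] at this
    linarith
  have c1 : euc (z.1 - z'.1) ≤ 2 * τ * r ^ 2 + 1 := by
    have : euc (z.1 - z'.1) ^ 2 = euc (z' - z).1 ^ 2 := by
      rw [← neg_sub, euc_sq, euc_sq, neg_dotProduct_neg]; rfl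
    nlinarith [sq_nonneg (euc (z.1 - z'.1) - 1)]
  have c2 : euc (z'.2 - z.2) ≤ 2 * σ * r ^ 2 + 1 := by
    have : euc (z'.2 - z.2) ^ 2 = euc (z' - z).2 ^ 2 := rfl
    nlinarith [sq_nonneg (euc (z'.2 - z.2) - 1)]
  exact add_le_add
    ((dotProduct_le_euc _ _).trans (mul_le_mul_of_nonneg_left c1 (euc_nonneg _)))
    ((dotProduct_le_euc _ _).trans (mul_le_mul_of_nonneg_left c2 (euc_nonneg _)))

lemma gap_le_mul_normGap (hS : StepBound A τ σ) {r : ℝ} (hr : 0 < r) {z z' : Iterate m n}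
    (hz' : 0 ≤ z'.1) (h : mNorm A τ σ (z' - z) ≤ r) :
    gap A b c z z' ≤ r * normGap A b c τ σ r z := by
  rw [normGap, ← mul_assoc, mul_one_div_cancel hr.ne', one_mul]
  exact le_csSup (bddAbove_gap_image hS r z) ⟨z', ⟨hz', h⟩, rfl⟩

lemma normGap_nonneg (hS : StepBound A τ σ) {r : ℝ} (hr : 0 ≤ r) {z : Iterate m n}
    (hz : 0 ≤ z.1) : 0 ≤ normGap A b c τ σ r z := by
  rcases hr.eq_or_lt with rfl | hr
  · simp [normGap]
  · have := gap_le_mul_normGap (A := A) (b := b) (c := c) hS hr hz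
      (z' := z) ((mNorm_sub_self z).trans_le hr.le)
    rw [gap_self] at this
    exact nonneg_of_mul_nonneg_right this hr

/-- After `k` steps the normalized gap of the average is at most `6 r / k`, where `r` is the
distance travelled. -/
lemma normGap_innerAvg_le (hS : StepBound A τ σ) (z : Iterate m n) {k : ℕ} (hk : 1 ≤ k) :
    normGap A b c τ σ (mNorm A τ σ (innerAvg A b c τ σ z k - z)) (innerAvg A b c τ σ z k)
      ≤ 6 * mNorm A τ σ (innerAvg A b c τ σ z k - z) / k := by
  have hk0 : (0 : ℝ) < k := by positivity
  set w := innerAvg A b c τ σ z k with hw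
  set r := mNorm A τ σ (w - z) with hr
  rcases (mNorm_nonneg (A := A) (τ := τ) (σ := σ) (w - z)).eq_or_lt with h0 | h0
  · rw [hr, ← h0]; simp [normGap]
  have hle : sSup ((fun z' : Iterate m n =>
      lagrangian A b c w.1 z'.2 - lagrangian A b c z'.1 w.2) ''
      {z' : Iterate m n | 0 ≤ z'.1 ∧ mNorm A τ σ (z' - w) ≤ r}) ≤ 6 * r ^ 2 / k := by
    refine csSup_le ?_ ?_
    · exact Set.Nonempty.image _ ⟨w, innerAvg_fst_nonneg z k, (mNorm_sub_self w).trans_le h0.le⟩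
    · rintro _ ⟨z', ⟨hz', hle⟩, rfl⟩
      change gap A b c w z' ≤ _
      have h1 := gap_innerAvg_le (b := b) (c := c) hS z z' hz' hk
      have h2 := pdhgSq_le_mNorm_sq hS (z' - z)
      have h3 := mNorm_sq_add_le hS (z' - w) (w - z)
      rw [sub_add_sub_cancel] at h3
      have h4 := pow_le_pow_left₀ (mNorm_nonneg _) hle 2
      rw [pdhgSq_sub_comm] at h1
      rw [le_div_iff₀ hk0]
      have : 2 * k * gap A b c w z' ≤ 12 * r ^ 2 := by linarith
      linarith
  rw [normGap]
  calc 1 / r * _ ≤ 1 / r * (6 * r ^ 2 / k) :=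
        mul_le_mul_of_nonneg_left hle (one_div_pos.mpr h0).le
    _ = 6 * r / k := by field_simp

end PrimalDual

/-! ### Test points for the normalized gap -/

section TestPoints

variable {m n : ℕ} {A : Matrix (Fin m) (Fin n) ℝ} {b : Fin m → ℝ} {c : Fin n → ℝ} {τ σ : ℝ}
  {z : Iterate m n} {r g : ℝ}

/-- The entrywise negative part of a vector. -/
def negVec {ι : Type*} (v : ι → ℝ) : ι → ℝ := fun j => max (-v j) 0

lemma dotProduct_negVec {ι : Type*} [Fintype ι] (v : ι → ℝ) :
    v ⬝ᵥ negVec v = -euc (negVec v) ^ 2 := by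
  rw [euc_sq, dotProduct, dotProduct, ← Finset.sum_neg_distrib]
  refine Finset.sum_congr rfl fun j _ => ?_
  unfold negVec
  rcases le_total (-v j) 0 with h | h
  · simp [max_eq_right h]
  · rw [max_eq_left h]; ring

lemma mNorm_sub_le_of_sq_le (hS : StepBound A τ σ) (hr : 0 ≤ r) {u : Iterate m n}
    (h : weightedSq τ σ u - 2 * ((A *ᵥ u.1) ⬝ᵥ u.2) ≤ r ^ 2) : mNorm A τ σ u ≤ r :=
  le_of_sq_le_sq ((mNorm_sq hS u).trans_le h) hr

/-- Testing the gap with a dual move along `b - A x` bounds the primal infeasibility. -/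
lemma primal_infeasibility_le (hS : StepBound A τ σ) (hr : 0 < r) (hz : 0 ≤ z.1)
    (hg : ∀ z' : Iterate m n, 0 ≤ z'.1 → mNorm A τ σ (z' - z) ≤ r → gap A b c z z' ≤ r * g) :
    Real.sqrt σ * euc (b - A *ᵥ z.1) ≤ g := by
  have hσ := hS.2.1
  set u := b - A *ᵥ z.1 with hu
  have hg0 : 0 ≤ g := by
    have := hg z hz ((mNorm_sub_self z).trans_le hr.le)
    rw [gap_self] at this
    exact nonneg_of_mul_nonneg_right this hr
  rcases (euc_nonneg u).eq_or_lt with h0 | h0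
  · rw [← h0, mul_zero]; exact hg0
  set t := r * Real.sqrt σ / euc u with ht
  have hsq := Real.sq_sqrt hσ.le
  have h := hg (z.1, z.2 + t • u) hz ?_
  · rw [gap_eq, ← hu] at h
    simp only [sub_self, dotProduct_zero, zero_add, add_sub_cancel_left, dotProduct_smul,
      smul_eq_mul, ← euc_sq] at h
    have : t * euc u ^ 2 = r * (Real.sqrt σ * euc u) := by rw [ht]; field_simp
    rw [this] at h
    exact le_of_mul_le_mul_left h hr
  · refine mNorm_sub_le_of_sq_le hS hr.le (le_of_eq ?_)
    simp only [weightedSq, Prod.fst_sub, Prod.snd_sub, sub_self, add_sub_cancel_left,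
      dotProduct_zero, mulVec_zero, zero_dotProduct, dotProduct_smul, smul_dotProduct, smul_eq_mul,
      ← euc_sq]
    rw [ht]
    field_simp
    rw [hsq]
    ring

/-- Testing the gap with a primal move along the negative part of the slack bounds the dual
infeasibility. -/
lemma dual_infeasibility_le (hS : StepBound A τ σ) (hr : 0 < r) (hz : 0 ≤ z.1)
    (hg : ∀ z' : Iterate m n, 0 ≤ z'.1 → mNorm A τ σ (z' - z) ≤ r → gap A b c z z' ≤ r * g) :
    Real.sqrt τ * euc (negVec (c - Aᵀ *ᵥ z.2)) ≤ g := by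
  have hτ := hS.1
  set u := negVec (c - Aᵀ *ᵥ z.2) with hu
  have hg0 : 0 ≤ g := by
    have := hg z hz ((mNorm_sub_self z).trans_le hr.le)
    rw [gap_self] at this
    exact nonneg_of_mul_nonneg_right this hr
  rcases (euc_nonneg u).eq_or_lt with h0 | h0
  · rw [← h0, mul_zero]; exact hg0
  set t := r * Real.sqrt τ / euc u with ht
  have ht0 : 0 ≤ t := by positivity
  have hsq := Real.sq_sqrt hτ.le
  have hu0 : 0 ≤ u := fun j => le_max_right _ _
  have h := hg (z.1 + t • u, z.2) (add_nonneg hz (smul_nonneg ht0 hu0)) ?_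
  · rw [gap_eq] at h
    simp only [sub_self, dotProduct_zero, add_zero, sub_add_cancel_left, dotProduct_neg,
      dotProduct_smul, smul_eq_mul] at h
    rw [hu, dotProduct_negVec, ← hu] at h
    have : -(t * -euc u ^ 2) = r * (Real.sqrt τ * euc u) := by rw [ht]; field_simp
    rw [this] at h
    exact le_of_mul_le_mul_left h hr
  · refine mNorm_sub_le_of_sq_le hS hr.le (le_of_eq ?_)
    simp only [weightedSq, Prod.fst_sub, Prod.snd_sub, sub_self, add_sub_cancel_left,
      dotProduct_zero, dotProduct_smul, smul_dotProduct, smul_eq_mul,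
      ← euc_sq]
    rw [ht]
    field_simp
    rw [hsq]
    ring

/-- Testing the gap with a shrinking of `z` towards the origin bounds the objective gap. -/
lemma objective_gap_le (hS : StepBound A τ σ) (hr : 0 < r) (hz : 0 ≤ z.1)
    (hg : ∀ z' : Iterate m n, 0 ≤ z'.1 → mNorm A τ σ (z' - z) ≤ r → gap A b c z z' ≤ r * g)
    {Q : ℝ} (hrQ : r ≤ Q) (hzQ : mNorm A τ σ z ≤ Q) : c ⬝ᵥ z.1 - b ⬝ᵥ z.2 ≤ g * Q := by
  have hQ : 0 < Q := hr.trans_le hrQ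
  set t := r / Q with ht
  have ht0 : 0 ≤ t := by positivity
  have ht1 : t ≤ 1 := (div_le_one hQ).mpr hrQ
  have h := hg ((1 - t) • z.1, (1 - t) • z.2) (smul_nonneg (by linarith) hz) ?_
  · have hval : gap A b c z ((1 - t) • z.1, (1 - t) • z.2) = t * (c ⬝ᵥ z.1 - b ⬝ᵥ z.2) := by
      simp only [gap_eq, sub_dotProduct, dotProduct_sub, dotProduct_smul, smul_eq_mul,
        transpose_mulVec_dotProduct]
      ring
    have hQr : r = t * Q := by rw [ht]; field_simp
    have htpos : 0 < t := by positivity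
    rw [hval] at h
    have h' : t * (c ⬝ᵥ z.1 - b ⬝ᵥ z.2) ≤ t * (g * Q) := by
      calc _ ≤ r * g := h
        _ = t * (g * Q) := by rw [hQr]; ring
    exact le_of_mul_le_mul_left h' htpos
  · have hsub : (((1 - t) • z.1, (1 - t) • z.2) : Iterate m n) - z = (-t) • z := by
      ext i <;> simp <;> ring
    rw [hsub]
    refine mNorm_sub_le_of_sq_le hS hr.le ?_
    have hform : weightedSq τ σ ((-t) • z) - 2 * ((A *ᵥ ((-t) • z).1) ⬝ᵥ ((-t) • z).2)
        = (t * mNorm A τ σ z) ^ 2 := by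
      rw [mul_pow, mNorm_sq hS]
      simp only [weightedSq, Prod.smul_fst, Prod.smul_snd, mulVec_smul, dotProduct_smul,
        smul_dotProduct, smul_eq_mul]
      ring
    rw [hform]
    refine pow_le_pow_left₀ (mul_nonneg ht0 (mNorm_nonneg _)) ?_ 2
    calc t * mNorm A τ σ z ≤ t * Q := mul_le_mul_of_nonneg_left hzQ ht0
      _ = r := by rw [ht]; field_simp

end TestPoints

/-! ### The tableau and the condition number -/

section Tableau

variable {m n : ℕ} {A : Matrix (Fin m) (Fin n) ℝ} {x s : Fin n → ℝ}
  (h : (basisSet x).card = m)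

lemma bijective_sumElim_basisIdx : Function.Bijective
    (Sum.elim (basisIdx x h) (Subtype.val : {j : Fin n // j ∉ basisSet x} → Fin n)) := by
  constructor
  · rintro (i | j) (i' | j') hij
    · exact congrArg _ (((basisSet x).orderEmbOfFin h).injective hij)
    · have hij' : basisIdx x h i = j' := hij
      exact absurd (hij' ▸ basisIdx_mem h i) j'.2
    · have hij' : j.1 = basisIdx x h i' := hij
      exact absurd (hij' ▸ basisIdx_mem h i') j.2
    · exact congrArg _ (Subtype.ext hij)
  · intro j
    by_cases hj : j ∈ basisSet x
    · obtain ⟨i, hi⟩ := exists_basisIdx_eq h hj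
      exact ⟨Sum.inl i, hi⟩
    · exact ⟨Sum.inr ⟨j, hj⟩, rfl⟩

lemma sum_eq_basis_add_nonbasis (f : Fin n → ℝ) :
    ∑ k, f k = ∑ i, f (basisIdx x h i) + ∑ j : {j : Fin n // j ∉ basisSet x}, f j := by
  rw [← (Equiv.ofBijective _ (bijective_sumElim_basisIdx h)).sum_comp, Fintype.sum_sum_type]
  rfl

lemma euc_eq_sumElim (d : Fin n → ℝ) :
    euc d = euc (Sum.elim (fun i => d (basisIdx x h i))
      (fun j : {j : Fin n // j ∉ basisSet x} => d j)) := by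
  refine (sq_eq_sq₀ (euc_nonneg _) (euc_nonneg _)).mp ?_
  rw [euc_sq, euc_sq, sumElim_dotProduct_sumElim, dotProduct, sum_eq_basis_add_nonbasis h]
  rfl

lemma euc_sumElim {ι κ : Type*} [Fintype ι] [Fintype κ] (u : ι → ℝ) (v : κ → ℝ) :
    euc (Sum.elim u v) = Real.sqrt (u ⬝ᵥ u + v ⬝ᵥ v) := by
  rw [← sumElim_dotProduct_sumElim, ← euc_sq, Real.sqrt_sq (euc_nonneg _)]

lemma mulVec_eq_basis_add_nonbasis (d : Fin n → ℝ) :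
    A *ᵥ d = basisMat A x h *ᵥ (fun i => d (basisIdx x h i))
      + nonbasisMat A x *ᵥ (fun j : {j : Fin n // j ∉ basisSet x} => d j) := by
  ext k
  simp only [mulVec, dotProduct, Pi.add_apply]
  rw [sum_eq_basis_add_nonbasis h]
  rfl

/-- The nonbasic entries of a vector of the kernel of `A` determine it: it is a combination of the
columns of the tableau, each extended by a unit vector. -/
lemma euc_le_of_mulVec_eq_zero (hB : IsUnit (basisMat A x h).det) {d : Fin n → ℝ}
    (hd : A *ᵥ d = 0) :
    euc d ≤ ∑ j : {j : Fin n // j ∉ basisSet x},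
      |d j| * Real.sqrt ((∑ i, tableau A x h i j ^ 2) + 1) := by
  classical
  set T := tableau A x h with hT
  set dN := fun j : {j : Fin n // j ∉ basisSet x} => d j with hdN
  have hdB : (fun i => d (basisIdx x h i)) = -(T *ᵥ dN) := by
    rw [mulVec_eq_basis_add_nonbasis h] at hd
    have h1 := congrArg ((basisMat A x h)⁻¹ *ᵥ ·) hd
    simp only [mulVec_add, mulVec_mulVec, nonsing_inv_mul _ hB, one_mulVec, mulVec_zero] at h1
    exact eq_neg_of_add_eq_zero_left h1
  have hsum : Sum.elim (fun i => d (basisIdx x h i)) dN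
      = ∑ j, dN j • Sum.elim (fun i => -T i j) (Pi.single j 1) := by
    ext k
    rw [Finset.sum_apply]
    rcases k with i | j
    · rw [Sum.elim_inl, congrFun hdB i]
      simp [mulVec, dotProduct, mul_comm]
    · simp [Pi.single_apply]
  rw [euc_eq_sumElim h, hsum]
  refine (euc_sum_smul_le _ _).trans (Finset.sum_le_sum fun j _ => le_of_eq ?_)
  rw [euc_sumElim, single_dotProduct, Pi.single_eq_same, mul_one]
  simp [dotProduct, sq, hdN]

/-- The basic entries of a vector of the row space of `A` determine it: it is a combination of the
rows of the tableau, each extended by a unit vector. -/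
lemma euc_transpose_mulVec_le (hB : IsUnit (basisMat A x h).det) (u : Fin m → ℝ) :
    euc (Aᵀ *ᵥ u) ≤ ∑ i, |(Aᵀ *ᵥ u) (basisIdx x h i)| *
      Real.sqrt ((∑ j, tableau A x h i j ^ 2) + 1) := by
  classical
  set T := tableau A x h with hT
  set q := Aᵀ *ᵥ u with hq
  have hqB : (fun i => q (basisIdx x h i)) = (basisMat A x h)ᵀ *ᵥ u := rfl
  have hqN : (fun j : {j : Fin n // j ∉ basisSet x} => q j)
      = Tᵀ *ᵥ (fun i => q (basisIdx x h i)) := by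
    have : Tᵀ * (basisMat A x h)ᵀ = (nonbasisMat A x)ᵀ := by
      rw [← transpose_mul, hT, tableau, ← Matrix.mul_assoc, mul_nonsing_inv _ hB, Matrix.one_mul]
    rw [hqB, mulVec_mulVec, this]
    rfl
  have hsum : Sum.elim (fun i => q (basisIdx x h i))
      (fun j : {j : Fin n // j ∉ basisSet x} => q j)
      = ∑ i, q (basisIdx x h i) • Sum.elim (Pi.single i 1) (fun j => T i j) := by
    ext k
    rw [Finset.sum_apply]
    rcases k with i | j
    · simp [Pi.single_apply]
    · rw [Sum.elim_inr, congrFun hqN j]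
      simp [mulVec, dotProduct, mul_comm]
  rw [euc_eq_sumElim h, hsum]
  refine (euc_sum_smul_le _ _).trans (Finset.sum_le_sum fun i _ => le_of_eq ?_)
  rw [euc_sumElim, single_dotProduct, Pi.single_eq_same, mul_one]
  simp [dotProduct, sq, add_comm]

/-- The scale `‖x‖₁ + ‖s‖₁` of the optimal solution. -/
def optScale (x s : Fin n → ℝ) : ℝ := (∑ i, |x i|) + ∑ i, |s i|

lemma optScale_nonneg (x s : Fin n → ℝ) : 0 ≤ optScale x s :=
  add_nonneg (Finset.sum_nonneg fun _ _ => abs_nonneg _) (Finset.sum_nonneg fun _ _ => abs_nonneg _)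

lemma euc_add_euc_le_optScale (x s : Fin n → ℝ) : euc x + euc s ≤ optScale x s :=
  add_le_add (euc_le_sum_abs x) (euc_le_sum_abs s)

lemma norm_pairVec_sq (u v : Fin n → ℝ) : ‖pairVec u v‖ ^ 2 = euc u ^ 2 + euc v ^ 2 := by
  rw [pairVec, ← euc, euc_sq, sumElim_dotProduct_sumElim, euc_sq, euc_sq]

lemma norm_pairVec_le_optScale (x s : Fin n → ℝ) : ‖pairVec x s‖ ≤ optScale x s := by
  refine le_trans ?_ (euc_add_euc_le_optScale x s)
  refine le_of_sq_le_sq ?_ (add_nonneg (euc_nonneg _) (euc_nonneg _))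
  rw [norm_pairVec_sq]
  linarith [mul_nonneg (euc_nonneg x) (euc_nonneg s)]

lemma optScale_mul_sqrt_le_Phi_mul_slack {j : Fin n} (hj : j ∉ basisSet x) (hs : 0 < s j) :
    optScale x s * Real.sqrt ((∑ i, tableau A x h i ⟨j, hj⟩ ^ 2) + 1) ≤ Phi A x s h * s j := by
  have h1 := le_ciSup (f := fun j : {j : Fin n // j ∉ basisSet x} =>
    Real.sqrt ((∑ i, tableau A x h i j ^ 2) + 1) / s j) (Set.finite_range _).bddAbove ⟨j, hj⟩
  rw [Phi, mul_assoc]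
  refine mul_le_mul_of_nonneg_left ?_ (optScale_nonneg x s)
  rw [← div_le_iff₀ hs]
  exact h1.trans (le_max_left _ _)

lemma optScale_mul_sqrt_le_Phi_mul_basic (i : Fin m) :
    optScale x s * Real.sqrt ((∑ j, tableau A x h i j ^ 2) + 1)
      ≤ Phi A x s h * x (basisIdx x h i) := by
  have hx : 0 < x (basisIdx x h i) := mem_basisSet.mp (basisIdx_mem h i)
  have h1 := le_ciSup (f := fun i : Fin m =>
    Real.sqrt ((∑ j, tableau A x h i j ^ 2) + 1) / x (basisIdx x h i))
    (Set.finite_range _).bddAbove i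
  rw [Phi, mul_assoc]
  refine mul_le_mul_of_nonneg_left ?_ (optScale_nonneg x s)
  rw [← div_le_iff₀ hx]
  exact h1.trans (le_max_right _ _)

end Tableau

/-! ### Error bound for the optimal pair -/

/-- The standing assumptions: `A` has at least one row and independent rows, `x` is the only primal
solution, `(y, s)` is the only dual solution, and `c` lies in the kernel of `A`. -/
structure UniqueOptima {m n : ℕ} (A : Matrix (Fin m) (Fin n) ℝ) (b : Fin m → ℝ) (c : Fin n → ℝ)
    (x s : Fin n → ℝ) (y : Fin m → ℝ) : Prop where
  rows_pos : 0 < m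
  rows : LinearIndependent ℝ A.row
  primal : primalOptima A b c = {x}
  dual : dualOptima A b c = {(y, s)}
  cost : A *ᵥ c = 0

namespace UniqueOptima

variable {m n : ℕ} {A : Matrix (Fin m) (Fin n) ℝ} {b : Fin m → ℝ} {c : Fin n → ℝ}
  {x s : Fin n → ℝ} {y : Fin m → ℝ} (D : UniqueOptima A b c x s y)

include D

lemma lamMin_pos : 0 < lamMin A := RPDHG.lamMin_pos A D.rows_pos D.rows

lemma lamMax_pos : 0 < lamMax A :=
  D.lamMin_pos.trans_le (lamMin_le_lamMax A D.rows_pos D.rows)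

lemma one_le_kappa : 1 ≤ kappa A :=
  (one_le_div D.lamMin_pos).mpr (lamMin_le_lamMax A D.rows_pos D.rows)

lemma mulVec_primal : A *ᵥ x = b := (mem_primalOptima_of_eq D.primal).1.1

lemma primal_nonneg : 0 ≤ x := (mem_primalOptima_of_eq D.primal).1.2

lemma dual_feasible : Aᵀ *ᵥ y + s = c := (mem_dualOptima_of_eq D.dual).1.1

lemma slack_nonneg : 0 ≤ s := (mem_dualOptima_of_eq D.dual).1.2

lemma slack_eq_zero {j : Fin n} (hj : 0 < x j) : s j = 0 :=
  (strict_complementarity D.primal D.dual).1 j hj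

lemma slack_pos {j : Fin n} (hj : j ∉ basisSet x) : 0 < s j :=
  (strict_complementarity D.primal D.dual).2 j fun h => hj (mem_basisSet.mpr h)

lemma primal_eq_zero {j : Fin n} (hj : j ∉ basisSet x) : x j = 0 :=
  le_antisymm (not_lt.mp fun h => hj (mem_basisSet.mpr h)) (D.primal_nonneg j)

lemma slack_dotProduct_primal : s ⬝ᵥ x = 0 := Finset.sum_eq_zero fun j _ => by
  by_cases hj : j ∈ basisSet x
  · rw [D.slack_eq_zero (mem_basisSet.mp hj), zero_mul]
  · rw [D.primal_eq_zero hj, mul_zero]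

lemma slack_eq : s = c - Aᵀ *ᵥ y := by rw [← D.dual_feasible, add_sub_cancel_left]

lemma isSaddlePoint : IsSaddlePoint A b c (x, y) := by
  refine isSaddlePoint_of_gap_nonpos D.primal_nonneg fun z' hz' => ?_
  rw [gap_eq, ← D.slack_eq, D.mulVec_primal, sub_self, zero_dotProduct, add_zero, dotProduct_sub,
    D.slack_dotProduct_primal, zero_sub, neg_nonpos]
  exact dotProduct_nonneg_of_nonneg D.slack_nonneg hz'

/-- Since `A c = 0`, the vector `c` is the orthogonal projection of `s` to the kernel of `A`, and
`-Aᵀ y` is the projection of `s` to the row space. -/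
lemma euc_transpose_mulVec_dual_le : euc (Aᵀ *ᵥ y) ≤ euc s := by
  have h0 : (Aᵀ *ᵥ y) ⬝ᵥ c = 0 := by rw [transpose_mulVec_dotProduct, D.cost, zero_dotProduct]
  have h1 : euc (Aᵀ *ᵥ y) ^ 2 = -((Aᵀ *ᵥ y) ⬝ᵥ s) := by
    rw [← D.dual_feasible, dotProduct_add] at h0
    rw [euc_sq]
    linarith
  have h2 := neg_le_of_abs_le (abs_dotProduct_le (Aᵀ *ᵥ y) s)
  rcases (euc_nonneg (Aᵀ *ᵥ y)).eq_or_lt with h | h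
  · rw [← h]; exact euc_nonneg s
  · have h3 : euc (Aᵀ *ᵥ y) * euc (Aᵀ *ᵥ y) ≤ euc (Aᵀ *ᵥ y) * euc s := by nlinarith
    exact le_of_mul_le_mul_left h3 h

lemma lamMin_mul_euc_dual_le : lamMin A * euc y ≤ euc s :=
  (lamMin_mul_euc_le A D.rows y).trans D.euc_transpose_mulVec_dual_le

/-- With the step sizes `1 / (2κ)` and `1 / (2 λ_max λ_min)`, the weights are `2κ` and
`2 λ_max λ_min`, and the mixed term is bounded through `‖A‖ = λ_max`. -/
lemma stepBound : StepBound A (1 / (2 * kappa A)) (1 / (2 * lamMax A * lamMin A)) := by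
  have hl := D.lamMin_pos
  have hL := D.lamMax_pos
  have hk : 0 < kappa A := one_pos.trans_le D.one_le_kappa
  refine ⟨by positivity, by positivity, fun z => ?_⟩
  have h1 := abs_dotProduct_le (A *ᵥ z.1) z.2
  have h2 := mul_le_mul_of_nonneg_right (euc_mulVec_le A D.rows_pos D.rows z.1) (euc_nonneg z.2)
  rw [weightedSq, one_div_one_div, one_div_one_div, ← euc_sq, ← euc_sq, abs_mul, abs_two]
  have h3 : kappa A * euc z.1 ^ 2 + lamMax A * lamMin A * euc z.2 ^ 2
      - 2 * (lamMax A * euc z.1 * euc z.2)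
      = lamMax A / lamMin A * (euc z.1 - lamMin A * euc z.2) ^ 2 := by
    rw [kappa]; field_simp; ring
  have h4 : 0 ≤ lamMax A / lamMin A * (euc z.1 - lamMin A * euc z.2) ^ 2 := by positivity
  linarith

lemma weightedSq_le (z : Iterate m n) :
    weightedSq (1 / (2 * kappa A)) (1 / (2 * lamMax A * lamMin A)) z
      ≤ 2 * kappa A * (euc z.1 ^ 2 + euc (Aᵀ *ᵥ z.2) ^ 2) := by
  have hl := D.lamMin_pos
  have hL := D.lamMax_pos
  rw [weightedSq, one_div_one_div, one_div_one_div, ← euc_sq, ← euc_sq]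
  have h1 := pow_le_pow_left₀ (mul_nonneg hl.le (euc_nonneg z.2))
    (lamMin_mul_euc_le A D.rows z.2) 2
  have h2 : lamMax A * lamMin A * euc z.2 ^ 2 = kappa A * (lamMin A * euc z.2) ^ 2 := by
    rw [kappa]; field_simp
  have h3 := mul_le_mul_of_nonneg_left h1 (zero_le_one.trans D.one_le_kappa)
  linarith

lemma exists_primal_pos : ∃ j, 0 < x j := by
  have h := card_basisSet D.primal D.dual
  exact ⟨_, mem_basisSet.mp (basisIdx_mem h ⟨0, D.rows_pos⟩)⟩

lemma optScale_pos : 0 < optScale x s := by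
  obtain ⟨j, hj⟩ := D.exists_primal_pos
  have h1 := Finset.single_le_sum (f := fun i => |x i|) (fun i _ => abs_nonneg (x i))
    (Finset.mem_univ j)
  have h2 : 0 ≤ ∑ i, |s i| := Finset.sum_nonneg fun _ _ => abs_nonneg _
  have h3 := le_abs_self (x j)
  unfold optScale
  linarith

variable (h : (basisSet x).card = m)

/-- For every index `j`, `x_j + s_j` is at least `(‖x‖₁ + ‖s‖₁) / Φ`. -/
lemma optScale_le_Phi_mul (j : Fin n) : optScale x s ≤ Phi A x s h * (|x j| + |s j|) := by
  have key : ∀ (q t : ℝ), 0 ≤ q → optScale x s * Real.sqrt (q + 1) ≤ t → optScale x s ≤ t := by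
    intro q t hq ht
    have : 1 ≤ Real.sqrt (q + 1) := Real.one_le_sqrt.mpr (by linarith)
    nlinarith [D.optScale_pos]
  by_cases hj : j ∈ basisSet x
  · obtain ⟨i, rfl⟩ := exists_basisIdx_eq h hj
    have := key _ _ (Finset.sum_nonneg fun _ _ => sq_nonneg _)
      (optScale_mul_sqrt_le_Phi_mul_basic (A := A) (s := s) h i)
    rwa [D.slack_eq_zero (mem_basisSet.mp hj), abs_zero, add_zero,
      abs_of_pos (mem_basisSet.mp hj)]
  · have := key _ _ (Finset.sum_nonneg fun _ _ => sq_nonneg _)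
      (optScale_mul_sqrt_le_Phi_mul_slack (A := A) h hj (D.slack_pos hj))
    rwa [D.primal_eq_zero hj, abs_zero, zero_add, abs_of_pos (D.slack_pos hj)]

lemma natCast_le_Phi : (n : ℝ) ≤ Phi A x s h := by
  have hsum : ∑ _j : Fin n, optScale x s ≤ ∑ j, Phi A x s h * (|x j| + |s j|) :=
    Finset.sum_le_sum fun j _ => D.optScale_le_Phi_mul h j
  rw [Finset.sum_const, Finset.card_univ, Fintype.card_fin, nsmul_eq_mul, ← Finset.mul_sum,
    Finset.sum_add_distrib] at hsum
  exact le_of_mul_le_mul_right hsum D.optScale_pos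

lemma one_le_Phi : 1 ≤ Phi A x s h := by
  obtain ⟨j, -⟩ := D.exists_primal_pos
  exact le_trans (by exact_mod_cast j.pos) (D.natCast_le_Phi h)

/-- The distance to `x` within the feasible affine space is controlled by the entries that multiply
the positive slacks. -/
lemma optScale_mul_euc_le_of_mulVec_eq_zero {d : Fin n → ℝ} (hd : A *ᵥ d = 0) :
    optScale x s * euc d ≤ Phi A x s h * ∑ j, |d j| * s j := by
  have hW := D.optScale_pos
  have hB := isUnit_det_basisMat D.primal D.dual h
  calc optScale x s * euc d
      ≤ optScale x s * ∑ j : {j : Fin n // j ∉ basisSet x},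
          |d j| * Real.sqrt ((∑ i, tableau A x h i j ^ 2) + 1) :=
        mul_le_mul_of_nonneg_left (euc_le_of_mulVec_eq_zero h hB hd) hW.le
    _ ≤ ∑ j : {j : Fin n // j ∉ basisSet x}, Phi A x s h * (|d j| * s j) := by
        rw [Finset.mul_sum]
        refine Finset.sum_le_sum fun j _ => ?_
        have := mul_le_mul_of_nonneg_left
          (optScale_mul_sqrt_le_Phi_mul_slack (A := A) h j.2 (D.slack_pos j.2)) (abs_nonneg (d j))
        calc _ = |d j| * (optScale x s * Real.sqrt ((∑ i, tableau A x h i j ^ 2) + 1)) := by ring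
          _ ≤ _ := this
          _ = _ := by ring
    _ = Phi A x s h * ∑ j, |d j| * s j := by
        rw [← Finset.mul_sum, sum_eq_basis_add_nonbasis h (fun j => |d j| * s j)]
        have : ∀ i, s (basisIdx x h i) = 0 := fun i =>
          D.slack_eq_zero (mem_basisSet.mp (basisIdx_mem h i))
        simp [this]

/-- The distance to `s` within the row space of `A` is controlled by the entries that multiply the
positive entries of `x`. -/
lemma optScale_mul_euc_transpose_mulVec_le (u : Fin m → ℝ) :
    optScale x s * euc (Aᵀ *ᵥ u) ≤ Phi A x s h * ∑ j, |(Aᵀ *ᵥ u) j| * x j := by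
  have hW := D.optScale_pos
  have hB := isUnit_det_basisMat D.primal D.dual h
  calc optScale x s * euc (Aᵀ *ᵥ u)
      ≤ optScale x s * ∑ i, |(Aᵀ *ᵥ u) (basisIdx x h i)| *
          Real.sqrt ((∑ j, tableau A x h i j ^ 2) + 1) :=
        mul_le_mul_of_nonneg_left (euc_transpose_mulVec_le h hB u) hW.le
    _ ≤ ∑ i, Phi A x s h * (|(Aᵀ *ᵥ u) (basisIdx x h i)| * x (basisIdx x h i)) := by
        rw [Finset.mul_sum]
        refine Finset.sum_le_sum fun i _ => ?_
        have := mul_le_mul_of_nonneg_left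
          (optScale_mul_sqrt_le_Phi_mul_basic (A := A) (s := s) h i)
          (abs_nonneg ((Aᵀ *ᵥ u) (basisIdx x h i)))
        calc _ = |(Aᵀ *ᵥ u) (basisIdx x h i)| *
              (optScale x s * Real.sqrt ((∑ j, tableau A x h i j ^ 2) + 1)) := by ring
          _ ≤ _ := this
          _ = _ := by ring
    _ = Phi A x s h * ∑ j, |(Aᵀ *ᵥ u) j| * x j := by
        rw [← Finset.mul_sum, sum_eq_basis_add_nonbasis h (fun j => |(Aᵀ *ᵥ u) j| * x j)]
        have : ∀ j : {j : Fin n // j ∉ basisSet x}, x j = 0 := fun j => D.primal_eq_zero j.2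
        simp [this]

/-- **Error bound.** Infeasibilities at most `δ` and a duality gap at most `5 δ (‖x‖₁ + ‖s‖₁)`
force the primal-dual pair to be within `O(Φ δ)` of the optimal one: the gap bounds the two
complementarity sums `s ⬝ x'` and `x ⬝ s'`, and these bound the distances through the tableau. -/
lemma error_bound {z : Iterate m n} (hz : 0 ≤ z.1) {δ : ℝ}
    (hp : euc (b - A *ᵥ z.1) ≤ lamMin A * δ) (hd : euc (negVec (c - Aᵀ *ᵥ z.2)) ≤ δ)
    (hg : c ⬝ᵥ z.1 - b ⬝ᵥ z.2 ≤ 5 * δ * optScale x s) :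
    euc (z.1 - x) ≤ 10 * (Phi A x s h * δ) ∧
      euc (c - Aᵀ *ᵥ z.2 - s) ≤ 8 * (Phi A x s h * δ) := by
  set W := optScale x s with hW
  have hW0 : 0 < W := D.optScale_pos
  have hl := D.lamMin_pos
  have hΦ := D.one_le_Phi h
  have hδ : 0 ≤ δ := (euc_nonneg _).trans hd
  have hxW : euc x ≤ W := by linarith [euc_add_euc_le_optScale x s, euc_nonneg s]
  have hsW : euc s ≤ W := by linarith [euc_add_euc_le_optScale x s, euc_nonneg x]
  set S := c - Aᵀ *ᵥ z.2 with hS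
  set u := b - A *ᵥ z.1 with hu
  -- The duality gap controls complementarity with the optimal solution.
  have hcomp : s ⬝ᵥ z.1 + S ⬝ᵥ x ≤ 6 * δ * W := by
    have h1 : s ⬝ᵥ z.1 + S ⬝ᵥ x = c ⬝ᵥ z.1 - b ⬝ᵥ z.2 + u ⬝ᵥ y := by
      have h2 : c ⬝ᵥ x = b ⬝ᵥ y := by
        have := D.slack_dotProduct_primal
        rw [D.slack_eq, sub_dotProduct, transpose_mulVec_dotProduct, D.mulVec_primal] at this
        linarith
      rw [D.slack_eq, hS, hu, sub_dotProduct, sub_dotProduct, sub_dotProduct,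
        transpose_mulVec_dotProduct, transpose_mulVec_dotProduct, D.mulVec_primal, h2]
      ring
    have h3 : u ⬝ᵥ y ≤ δ * W := by
      calc u ⬝ᵥ y ≤ euc u * euc y := dotProduct_le_euc _ _
        _ ≤ lamMin A * δ * euc y := mul_le_mul_of_nonneg_right hp (euc_nonneg _)
        _ = δ * (lamMin A * euc y) := by ring
        _ ≤ δ * W := mul_le_mul_of_nonneg_left (D.lamMin_mul_euc_dual_le.trans hsW) hδ
    linarith
  have habs : ∑ j, |S j| * x j ≤ S ⬝ᵥ x + 2 * (δ * W) := by
    have h1 : ∀ j, |S j| * x j = S j * x j + 2 * (negVec S j * x j) := by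
      intro j
      unfold negVec
      rcases le_total (S j) 0 with hj | hj
      · rw [abs_of_nonpos hj, max_eq_left (by linarith)]; ring
      · rw [abs_of_nonneg hj, max_eq_right (by linarith)]; ring
    have h2 : negVec S ⬝ᵥ x ≤ δ * W :=
      (dotProduct_le_euc _ _).trans (mul_le_mul hd hxW (euc_nonneg _) hδ)
    rw [Finset.sum_congr rfl fun j _ => h1 j, Finset.sum_add_distrib, ← Finset.mul_sum]
    exact add_le_add le_rfl (mul_le_mul_of_nonneg_left h2 two_pos.le)
  have hsz : 0 ≤ s ⬝ᵥ z.1 := dotProduct_nonneg_of_nonneg D.slack_nonneg hz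
  have hSx : 0 ≤ ∑ j, |S j| * x j :=
    Finset.sum_nonneg fun j _ => mul_nonneg (abs_nonneg _) (D.primal_nonneg j)
  constructor
  · -- The minimum-norm correction `Aᵀ v` moves `z.1` to the affine space `A x' = b`.
    obtain ⟨v, hv⟩ := exists_mulVec_mulVec_transpose_eq A D.rows u
    set p := Aᵀ *ᵥ v with hpdef
    have hpδ : euc p ≤ δ := by
      have h1 : euc p ^ 2 ≤ euc u * euc v := by
        rw [euc_sq, hpdef, transpose_mulVec_dotProduct, hv]
        exact dotProduct_le_euc _ _
      have h2 : euc u * euc v ≤ δ * euc p := by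
        calc euc u * euc v ≤ lamMin A * δ * euc v := mul_le_mul_of_nonneg_right hp (euc_nonneg _)
          _ = δ * (lamMin A * euc v) := by ring
          _ ≤ δ * euc p := mul_le_mul_of_nonneg_left (lamMin_mul_euc_le A D.rows v) hδ
      nlinarith [euc_nonneg p]
    have hker : A *ᵥ (z.1 + p - x) = 0 := by
      rw [mulVec_sub, mulVec_add, hv, D.mulVec_primal, hu]
      abel
    have h1 := D.optScale_mul_euc_le_of_mulVec_eq_zero h hker
    have h2 : ∑ j, |(z.1 + p - x) j| * s j ≤ s ⬝ᵥ z.1 + δ * W := by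
      have h3 : ∀ j, |(z.1 + p - x) j| * s j ≤ s j * z.1 j + |p j| * s j := by
        intro j
        have hsj := D.slack_nonneg j
        by_cases hj : j ∈ basisSet x
        · simp [D.slack_eq_zero (mem_basisSet.mp hj)]
        · have : |(z.1 + p - x) j| ≤ z.1 j + |p j| := by
            simp only [Pi.sub_apply, Pi.add_apply, D.primal_eq_zero hj, sub_zero]
            refine (abs_add_le _ _).trans_eq ?_
            rw [abs_of_nonneg (hz j)]
          calc _ ≤ (z.1 j + |p j|) * s j := mul_le_mul_of_nonneg_right this hsj
            _ = _ := by ring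
      refine (Finset.sum_le_sum fun j _ => h3 j).trans ?_
      rw [Finset.sum_add_distrib]
      refine add_le_add le_rfl ?_
      have habsp : euc (fun j => |p j|) = euc p := by
        refine (sq_eq_sq₀ (euc_nonneg _) (euc_nonneg _)).mp ?_
        simp [euc_sq, dotProduct]
      calc _ ≤ euc (fun j => |p j|) * euc s := dotProduct_le_euc (fun j => |p j|) s
        _ ≤ δ * W := mul_le_mul (habsp.trans_le hpδ) hsW (euc_nonneg _) hδ
    have h4 : W * euc (z.1 + p - x) ≤ W * (9 * (Phi A x s h * δ)) := by
      calc _ ≤ Phi A x s h * ∑ j, |(z.1 + p - x) j| * s j := h1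
        _ ≤ Phi A x s h * (9 * δ * W) :=
          mul_le_mul_of_nonneg_left (by linarith) (by linarith)
        _ = _ := by ring
    have h5 := le_of_mul_le_mul_left h4 hW0
    have h6 : z.1 - x = (z.1 + p - x) + (-p) := by abel
    have h7 : euc (-p) = euc p := by simp [euc]
    have h8 := euc_add_le (z.1 + p - x) (-p)
    rw [← h6, h7] at h8
    have h9 : δ ≤ Phi A x s h * δ := le_mul_of_one_le_left hδ hΦ
    linarith
  · have hdiff : S - s = Aᵀ *ᵥ (y - z.2) := by
      rw [mulVec_sub, hS, D.slack_eq]; abel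
    have h1 := D.optScale_mul_euc_transpose_mulVec_le h (y - z.2)
    rw [← hdiff] at h1
    have h2 : ∑ j, |(S - s) j| * x j = ∑ j, |S j| * x j := by
      refine Finset.sum_congr rfl fun j _ => ?_
      by_cases hj : j ∈ basisSet x
      · rw [Pi.sub_apply, D.slack_eq_zero (mem_basisSet.mp hj), sub_zero]
      · rw [D.primal_eq_zero hj, mul_zero, mul_zero]
    rw [h2] at h1
    refine le_of_mul_le_mul_left (h1.trans ?_) hW0
    calc _ ≤ Phi A x s h * (8 * δ * W) := mul_le_mul_of_nonneg_left (by linarith) (by linarith)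
      _ = _ := by ring

end UniqueOptima

/-! ### Linear convergence of the restarts -/

lemma one_div_mul_exp_neg (N : ℕ) : 1 / Real.exp 1 * Real.exp (-N) = Real.exp (-(N + 1 : ℕ)) := by
  rw [one_div, ← Real.exp_neg, ← Real.exp_add]
  push_cast
  ring_nf

/-- The properties of an outer iterate `z` with predecessor `zprev` that every outer loop
preserves: it is no farther than the origin from the solution, the last move was nonzero and of
bounded length, and the normalized gap is at most `g`. -/
structure OuterBound {m n : ℕ} (A : Matrix (Fin m) (Fin n) ℝ) (b : Fin m → ℝ) (c x : Fin n → ℝ)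
    (y : Fin m → ℝ) (zprev z : Iterate m n) (g : ℝ) : Prop where
  nonneg : 0 ≤ z.1
  ne : z ≠ zprev
  dist_le : pdhgSq A (1 / (2 * kappa A)) (1 / (2 * lamMax A * lamMin A)) (z - (x, y))
    ≤ pdhgSq A (1 / (2 * kappa A)) (1 / (2 * lamMax A * lamMin A)) (x, y)
  move_le : mNorm A (1 / (2 * kappa A)) (1 / (2 * lamMax A * lamMin A)) (z - zprev) ^ 2
    ≤ 12 * pdhgSq A (1 / (2 * kappa A)) (1 / (2 * lamMax A * lamMin A)) (x, y)
  gap_le : normGap A b c (1 / (2 * kappa A)) (1 / (2 * lamMax A * lamMin A))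
    (mNorm A (1 / (2 * kappa A)) (1 / (2 * lamMax A * lamMin A)) (z - zprev)) z ≤ g

/-- The number of inner iterations after which a restart is guaranteed. -/
def loopBound {m n : ℕ} (A : Matrix (Fin m) (Fin n) ℝ) (x s : Fin n → ℝ)
    (h : (basisSet x).card = m) : ℕ :=
  ⌈2000 * (kappa A * Phi A x s h)⌉₊

namespace UniqueOptima

variable {m n : ℕ} {A : Matrix (Fin m) (Fin n) ℝ} {b : Fin m → ℝ} {c : Fin n → ℝ}
  {x s : Fin n → ℝ} {y : Fin m → ℝ} (D : UniqueOptima A b c x s y)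

include D

lemma twelve_mul_pdhgSq_le :
    12 * pdhgSq A (1 / (2 * kappa A)) (1 / (2 * lamMax A * lamMin A)) (x, y)
      ≤ (5 * Real.sqrt (2 * kappa A) * ‖pairVec x s‖) ^ 2 := by
  have hk := D.one_le_kappa
  have h1 := pdhgSq_le_weightedSq D.stepBound (x, y)
  have h2 := D.weightedSq_le (x, y)
  have h3 := pow_le_pow_left₀ (euc_nonneg _) D.euc_transpose_mulVec_dual_le 2
  have h4 : 2 * kappa A * (euc x ^ 2 + euc (Aᵀ *ᵥ y) ^ 2) ≤ 2 * kappa A * ‖pairVec x s‖ ^ 2 := by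
    rw [norm_pairVec_sq]
    exact mul_le_mul_of_nonneg_left (by linarith) (by linarith)
  have h5 : 0 ≤ 2 * kappa A * ‖pairVec x s‖ ^ 2 := by positivity
  rw [mul_pow, mul_pow, Real.sq_sqrt (by linarith)]
  linarith

lemma norm_pairVec_pos : 0 < ‖pairVec x s‖ := by
  refine lt_of_le_of_ne (norm_nonneg _) fun h0 => ?_
  have h1 := norm_pairVec_sq x s
  rw [← h0] at h1
  have h2 : euc x = 0 := by nlinarith [sq_nonneg (euc x), sq_nonneg (euc s)]
  obtain ⟨j, hj⟩ := D.exists_primal_pos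
  rw [euc_eq_zero.mp h2] at hj
  exact lt_irrefl _ hj

variable (h : (basisSet x).card = m)

/-- A normalized gap of at most `g` on the ball of radius `r` puts `z` within `O(Φ √κ g)` of the
optimal pair, provided `r` and `‖z‖_M` are at most of order `√κ (‖x‖₁ + ‖s‖₁)`. -/
lemma sharpness {z : Iterate m n} (hz : 0 ≤ z.1) {r g Q : ℝ} (hr : 0 < r) (hrQ : r ≤ Q)
    (hzQ : mNorm A (1 / (2 * kappa A)) (1 / (2 * lamMax A * lamMin A)) z ≤ Q)
    (hgQ : g * Q ≤ 5 * (Real.sqrt (2 * kappa A) * g) * optScale x s)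
    (hg : ∀ z' : Iterate m n, 0 ≤ z'.1 →
      mNorm A (1 / (2 * kappa A)) (1 / (2 * lamMax A * lamMin A)) (z' - z) ≤ r →
      gap A b c z z' ≤ r * g) :
    euc (z.1 - x) ≤ 10 * (Phi A x s h * (Real.sqrt (2 * kappa A) * g)) ∧
      euc (c - Aᵀ *ᵥ z.2 - s) ≤ 8 * (Phi A x s h * (Real.sqrt (2 * kappa A) * g)) := by
  have hS := D.stepBound
  have hl := D.lamMin_pos
  have hL := D.lamMax_pos
  have hk : 0 < kappa A := one_pos.trans_le D.one_le_kappa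
  refine D.error_bound h hz ?_ ?_ ((objective_gap_le hS hr hz hg hrQ hzQ).trans hgQ)
  · have h1 := primal_infeasibility_le hS hr hz hg
    have h2 : 2 * lamMax A * lamMin A = lamMin A ^ 2 * (2 * kappa A) := by
      rw [kappa]; field_simp
    have h3 : Real.sqrt (1 / (2 * lamMax A * lamMin A))
        = 1 / (lamMin A * Real.sqrt (2 * kappa A)) := by
      rw [h2, Real.sqrt_div zero_le_one, Real.sqrt_one, Real.sqrt_mul (sq_nonneg _),
        Real.sqrt_sq hl.le]
    rw [h3, one_div, inv_mul_le_iff₀ (by positivity)] at h1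
    linarith
  · have h1 := dual_infeasibility_le hS hr hz hg
    rw [Real.sqrt_div zero_le_one, Real.sqrt_one, one_div, inv_mul_le_iff₀ (by positivity)] at h1
    exact h1

/-- A saddle point has gap at most `0`, so it is the optimal solution. -/
lemma eq_of_isSaddlePoint {z : Iterate m n} (hz : IsSaddlePoint A b c z) :
    z.1 = x ∧ c - Aᵀ *ᵥ z.2 = s := by
  have h := card_basisSet D.primal D.dual
  have := D.sharpness h hz.1 (r := 1) (g := 0) one_pos (le_max_left _ _) (le_max_right _ _)
    (by simp) (fun z' hz' _ => by simpa using gap_nonpos_of_isSaddlePoint hz z' hz')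
  simp only [mul_zero] at this
  exact ⟨sub_eq_zero.mp (euc_eq_zero.mp (le_antisymm this.1 (euc_nonneg _))),
    sub_eq_zero.mp (euc_eq_zero.mp (le_antisymm this.2 (euc_nonneg _)))⟩

lemma epsOptimal_of_norm_le {ε : ℝ} {u v : Fin n → ℝ} (hle : ‖pairVec (u - x) (v - s)‖ ≤ ε) :
    EpsOptimal A b c ε (pairVec u v) := by
  have hmem : pairVec x s ∈ optimalPairs A b c :=
    ⟨x, s, y, mem_primalOptima_of_eq D.primal, mem_dualOptima_of_eq D.dual, rfl⟩
  refine (Metric.infDist_le_dist_of_mem hmem).trans ?_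
  have : pairVec u v - pairVec x s = pairVec (u - x) (v - s) := by
    ext (i | i) <;> simp [pairVec]
  rw [dist_eq_norm, this]
  exact hle

lemma epsOptimal_of_isSaddlePoint {z : Iterate m n} (hz : IsSaddlePoint A b c z) {ε : ℝ}
    (hε : 0 < ε) : EpsOptimal A b c ε (pairVec z.1 (c - Aᵀ *ᵥ z.2)) := by
  obtain ⟨h1, h2⟩ := D.eq_of_isSaddlePoint hz
  refine D.epsOptimal_of_norm_le ?_
  have : ‖pairVec (0 : Fin n → ℝ) (0 : Fin n → ℝ)‖ ^ 2 = 0 := by simp [norm_pairVec_sq, euc_sq]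
  rw [h1, h2, sub_self, sub_self, pow_eq_zero_iff two_ne_zero |>.mp this]
  exact hε.le

lemma outerBound_sharpness {zprev z : Iterate m n} {g : ℝ} (hz : OuterBound A b c x y zprev z g) :
    euc (z.1 - x) ≤ 10 * (Phi A x s h * (Real.sqrt (2 * kappa A) * g)) ∧
      euc (c - Aᵀ *ᵥ z.2 - s) ≤ 8 * (Phi A x s h * (Real.sqrt (2 * kappa A) * g)) := by
  have hS := D.stepBound
  set τ := 1 / (2 * kappa A) with hτ
  set σ := 1 / (2 * lamMax A * lamMin A) with hσ
  have hr := mNorm_sub_pos hS hz.ne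
  have hg0 : 0 ≤ g := (normGap_nonneg hS hr.le hz.nonneg).trans hz.gap_le
  have hQ := D.twelve_mul_pdhgSq_le
  have hQ0 : 0 ≤ 5 * Real.sqrt (2 * kappa A) * ‖pairVec x s‖ := by positivity
  refine D.sharpness h hz.nonneg hr (Q := 5 * Real.sqrt (2 * kappa A) * ‖pairVec x s‖)
    (le_of_sq_le_sq (hz.move_le.trans hQ) hQ0) (le_of_sq_le_sq ?_ hQ0) ?_ fun z' hz' hle => ?_
  · have h1 := mNorm_sq_le hS z
    have h2 := pdhgSq_add_le hS (z - (x, y)) (x, y)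
    rw [sub_add_cancel] at h2
    linarith [hz.dist_le]
  · have := mul_le_mul_of_nonneg_left (norm_pairVec_le_optScale x s)
      (mul_nonneg hg0 (mul_nonneg (by norm_num : (0 : ℝ) ≤ 5) (Real.sqrt_nonneg (2 * kappa A))))
    linarith
  · exact (gap_le_mul_normGap hS hr hz' hle).trans (mul_le_mul_of_nonneg_left hz.gap_le hr.le)

/-- One more outer loop: the distance to the solution is `O(κ Φ g)` by sharpness, hence the
normalized gap of the average drops below `g / e` within `O(κ Φ)` iterations. -/
lemma exists_isLeast_restart {zprev z : Iterate m n} {g : ℝ}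
    (hz : OuterBound A b c x y zprev z g)
    (hns : ¬ IsSaddlePoint A b c z) {N : ℕ} (hN : 1 ≤ N) :
    ∃ k ≤ loopBound A x s h,
      IsLeast {k : ℕ | 1 ≤ k ∧ RestartCond A b c (1 / (2 * kappa A))
        (1 / (2 * lamMax A * lamMin A)) (1 / Real.exp 1) N zprev z k} k ∧
      OuterBound A b c x y z (innerAvg A b c (1 / (2 * kappa A)) (1 / (2 * lamMax A * lamMin A)) z k)
        (1 / Real.exp 1 * g) := by
  have hS := D.stepBound
  have hsad := D.isSaddlePoint
  set τ := 1 / (2 * kappa A) with hτ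
  set σ := 1 / (2 * lamMax A * lamMin A) with hσ
  have hk1 := D.one_le_kappa
  have hΦ := D.one_le_Phi h
  set P := kappa A * Phi A x s h with hP
  have hP1 : 1 ≤ P := by nlinarith
  -- Apply sharpness with the exact normalized gap, the right-hand side of the restart condition.
  set g₀ := normGap A b c τ σ (mNorm A τ σ (z - zprev)) z with hg₀
  have hg₀0 : 0 ≤ g₀ := normGap_nonneg hS (mNorm_nonneg _) hz.nonneg
  have hz₀ : OuterBound A b c x y zprev z g₀ := ⟨hz.nonneg, hz.ne, hz.dist_le, hz.move_le, le_rfl⟩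
  obtain ⟨e1, e2⟩ := D.outerBound_sharpness h hz₀
  have hdist : 12 * pdhgSq A τ σ (z - (x, y)) ≤ (109 * (P * g₀)) ^ 2 := by
    have h1 := pdhgSq_le_weightedSq hS (z - (x, y))
    have h2 := D.weightedSq_le (z - (x, y))
    have h3 : euc (Aᵀ *ᵥ (z - (x, y)).2) = euc (c - Aᵀ *ᵥ z.2 - s) := by
      have : c - Aᵀ *ᵥ z.2 - s = -(Aᵀ *ᵥ (z - (x, y)).2) := by
        rw [Prod.snd_sub, mulVec_sub, D.slack_eq]; abel
      rw [this]
      simp [euc]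
    have e1' := pow_le_pow_left₀ (euc_nonneg _) e1 2
    have e2' := pow_le_pow_left₀ (euc_nonneg _) e2 2
    rw [h3] at h2
    have h4 : 2 * kappa A * (euc (z.1 - x) ^ 2 + euc (c - Aᵀ *ᵥ z.2 - s) ^ 2)
        ≤ 2 * kappa A * (164 * (Phi A x s h * (Real.sqrt (2 * kappa A) * g₀)) ^ 2) :=
      mul_le_mul_of_nonneg_left (by linarith) (by linarith)
    have h5 : 2 * kappa A * (164 * (Phi A x s h * (Real.sqrt (2 * kappa A) * g₀)) ^ 2)
        = 656 * (P * g₀) ^ 2 := by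
      rw [mul_pow, mul_pow, Real.sq_sqrt (by linarith), hP]; ring
    have h6 : (109 * (P * g₀)) ^ 2 = 11881 * (P * g₀) ^ 2 := by ring
    rw [h6]
    rw [h5] at h4
    have h7 : weightedSq τ σ (z - (x, y)) ≤ 656 * (P * g₀) ^ 2 := h2.trans h4
    linarith [sq_nonneg (P * g₀)]
  have hrest : RestartCond A b c τ σ (1 / Real.exp 1) N zprev z (loopBound A x s h) ∧
      1 ≤ loopBound A x s h := by
    have hK : 2000 * P ≤ (loopBound A x s h : ℝ) := Nat.le_ceil _
    have hK0 : (0 : ℝ) < loopBound A x s h := by linarith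
    have hK1 : 1 ≤ loopBound A x s h := by exact_mod_cast hK0
    refine ⟨Or.inr ⟨hN, (normGap_innerAvg_le hS z hK1).trans ?_⟩, hK1⟩
    have hr := le_of_sq_le_sq ((mNorm_innerAvg_sub_sq_le hS hsad z hK1).trans hdist)
      (by positivity)
    rw [← hg₀, div_le_iff₀ hK0]
    have he : (1 / 3 : ℝ) ≤ 1 / Real.exp 1 :=
      one_div_le_one_div_of_le (Real.exp_pos 1) (by linarith [Real.exp_one_lt_d9])
    calc 6 * _ ≤ 6 * (109 * (P * g₀)) := mul_le_mul_of_nonneg_left hr (by norm_num)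
      _ ≤ 1 / 3 * g₀ * (2000 * P) := by nlinarith [mul_nonneg (zero_le_one.trans hP1) hg₀0]
      _ ≤ 1 / Real.exp 1 * g₀ * (loopBound A x s h) := by gcongr
  classical
  have hex : ∃ k, 1 ≤ k ∧ RestartCond A b c τ σ (1 / Real.exp 1) N zprev z k :=
    ⟨_, hrest.2, hrest.1⟩
  have hk := Nat.find_spec hex
  have hmin : ∀ k, 1 ≤ k ∧ RestartCond A b c τ σ (1 / Real.exp 1) N zprev z k →
    Nat.find hex ≤ k := fun k hk' => Nat.find_min' hex hk'
  refine ⟨Nat.find hex, hmin _ ⟨hrest.2, hrest.1⟩, ⟨hk, fun k hk' => hmin k hk'⟩, ?_⟩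
  generalize Nat.find hex = k at hk
  obtain ⟨hk1, hk⟩ := hk
  refine ⟨innerAvg_fst_nonneg _ _, innerAvg_ne hS hsad hns hk1,
    (pdhgSq_innerAvg_le_start hS hsad z hk1).trans hz.dist_le,
    (mNorm_innerAvg_sub_sq_le hS hsad z hk1).trans
      (mul_le_mul_of_nonneg_left hz.dist_le (by norm_num)), ?_⟩
  rcases hk with hk | hk
  · omega
  · exact hk.2.trans (mul_le_mul_of_nonneg_left hz.gap_le (by positivity))

/-- After `N` regular outer loops, unless a saddle point was met before, the normalized gap has
decreased by the factor `e^(-N)`. -/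
lemma exists_reaches (N : ℕ) :
    (∃ (N' T : ℕ) (zprev z : Iterate m n),
      Reaches A b c (1 / (2 * kappa A)) (1 / (2 * lamMax A * lamMin A)) (1 / Real.exp 1)
        N' T zprev z ∧ IsSaddlePoint A b c z ∧ T ≤ 1 + N * loopBound A x s h) ∨
    ∃ (T : ℕ) (zprev z : Iterate m n),
      Reaches A b c (1 / (2 * kappa A)) (1 / (2 * lamMax A * lamMin A)) (1 / Real.exp 1)
        (N + 1) T zprev z ∧ T ≤ 1 + N * loopBound A x s h ∧
      OuterBound A b c x y zprev z
        (30 * Real.sqrt (2 * kappa A) * ‖pairVec x s‖ * Real.exp (-N)) := by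
  have hS := D.stepBound
  have hsad := D.isSaddlePoint
  induction N with
  | zero =>
    by_cases h0 : IsSaddlePoint A b c (0 : Iterate m n)
    · exact Or.inl ⟨0, 0, 0, 0, Reaches.start, h0, by omega⟩
    · right
      refine ⟨0 + 1, 0, _, Reaches.outer Reaches.start h0
        ⟨⟨le_rfl, Or.inl ⟨rfl, rfl⟩⟩, fun k hk => hk.1⟩, by omega, innerAvg_fst_nonneg _ _,
        innerAvg_ne hS hsad h0 le_rfl, ?_, ?_, ?_⟩
      · refine (pdhgSq_innerAvg_le_start hS hsad 0 le_rfl).trans (le_of_eq ?_)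
        rw [zero_sub, pdhgSq_neg]
      · refine (mNorm_innerAvg_sub_sq_le hS hsad 0 le_rfl).trans (le_of_eq ?_)
        rw [zero_sub, pdhgSq_neg]
      · refine (normGap_innerAvg_le hS 0 le_rfl).trans ?_
        have h1 := mNorm_innerAvg_sub_sq_le hS hsad 0 (le_refl 1)
        rw [zero_sub, pdhgSq_neg] at h1
        have h2 := le_of_sq_le_sq (h1.trans D.twelve_mul_pdhgSq_le) (by positivity)
        simp only [Nat.cast_one, Nat.cast_zero, neg_zero, Real.exp_zero, mul_one, div_one]
        linarith
  | succ N ih =>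
    have hmono : 1 + N * loopBound A x s h ≤ 1 + (N + 1) * loopBound A x s h := by
      rw [Nat.succ_mul]; omega
    rcases ih with ⟨N', T, zprev, z, hR, hz, hT⟩ | ⟨T, zprev, z, hR, hT, hz⟩
    · exact Or.inl ⟨N', T, zprev, z, hR, hz, hT.trans hmono⟩
    by_cases hns : IsSaddlePoint A b c z
    · exact Or.inl ⟨N + 1, T, zprev, z, hR, hns, hT.trans hmono⟩
    obtain ⟨k, hk, hleast, hz'⟩ := D.exists_isLeast_restart h hz hns (Nat.le_add_left 1 N)
    refine Or.inr ⟨T + k, z, _, Reaches.outer hR hns hleast, ?_, ?_⟩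
    · rw [Nat.succ_mul]; omega
    · rw [← one_div_mul_exp_neg N, mul_left_comm]
      exact hz'

/-- The origin is within `‖w‖` of the optimal pair `w`, because `‖c - s‖ = ‖Aᵀ y‖ ≤ ‖s‖`. -/
lemma epsOptimal_zero {ε : ℝ} (hε : ‖pairVec x s‖ ≤ ε) :
    EpsOptimal A b c ε (pairVec (0 : Iterate m n).1 (c - Aᵀ *ᵥ (0 : Iterate m n).2)) := by
  refine D.epsOptimal_of_norm_le (le_trans (le_of_sq_le_sq ?_ (norm_nonneg _)) hε)
  have h1 : c - Aᵀ *ᵥ (0 : Iterate m n).2 - s = Aᵀ *ᵥ y := by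
    rw [Prod.snd_zero, mulVec_zero, ← D.dual_feasible]; abel
  have h2 : euc ((0 : Iterate m n).1 - x) = euc x := by simp [euc]
  rw [norm_pairVec_sq, norm_pairVec_sq, h1, h2]
  have := pow_le_pow_left₀ (euc_nonneg _) D.euc_transpose_mulVec_dual_le 2
  linarith

lemma epsOptimal_of_outerBound {zprev z : Iterate m n} {N : ℕ} {ε : ℝ}
    (hz : OuterBound A b c x y zprev z (30 * Real.sqrt (2 * kappa A) * ‖pairVec x s‖ * Real.exp (-N)))
    (hε : 1080 * (kappa A * Phi A x s h * ‖pairVec x s‖) * Real.exp (-N) ≤ ε) :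
    EpsOptimal A b c ε (pairVec z.1 (c - Aᵀ *ᵥ z.2)) := by
  obtain ⟨e1, e2⟩ := D.outerBound_sharpness h hz
  have hk := D.one_le_kappa
  refine D.epsOptimal_of_norm_le (le_trans ?_ hε)
  have hle : ‖pairVec (z.1 - x) (c - Aᵀ *ᵥ z.2 - s)‖
      ≤ euc (z.1 - x) + euc (c - Aᵀ *ᵥ z.2 - s) := by
    refine le_of_sq_le_sq ?_ (add_nonneg (euc_nonneg _) (euc_nonneg _))
    rw [norm_pairVec_sq]
    linarith [mul_nonneg (euc_nonneg (z.1 - x)) (euc_nonneg (c - Aᵀ *ᵥ z.2 - s))]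
  have hsq : Real.sqrt (2 * kappa A) * Real.sqrt (2 * kappa A) = 2 * kappa A :=
    Real.mul_self_sqrt (by linarith)
  calc _ ≤ 18 * (Phi A x s h * (Real.sqrt (2 * kappa A) *
        (30 * Real.sqrt (2 * kappa A) * ‖pairVec x s‖ * Real.exp (-N)))) := by linarith
    _ = 540 * (Real.sqrt (2 * kappa A) * Real.sqrt (2 * kappa A)) *
        (Phi A x s h * ‖pairVec x s‖ * Real.exp (-N)) := by ring
    _ = _ := by rw [hsq]; ring

/-- The iteration bound, with the absolute constant made explicit. -/
lemma exists_epsOptimal {ε : ℝ} (hε : 0 < ε) (hn : 2 ≤ n ∨ ε ≤ ‖pairVec x s‖ / 2) :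
    ∃ (N T : ℕ) (zprev z : Iterate m n),
      Reaches A b c (1 / (2 * kappa A)) (1 / (2 * lamMax A * lamMin A)) (1 / Real.exp 1)
        N T zprev z ∧
      EpsOptimal A b c ε (pairVec z.1 (c - Aᵀ *ᵥ z.2)) ∧
      (T : ℝ) ≤ 40000 * (kappa A * Phi A x s h *
        max 0 (Real.log (kappa A * Phi A x s h * ‖pairVec x s‖ / ε))) := by
  have hk1 := D.one_le_kappa
  have hΦ := D.one_le_Phi h
  have hw := D.norm_pairVec_pos
  set w := ‖pairVec x s‖ with hwdef
  set P := kappa A * Phi A x s h with hP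
  have hP1 : 1 ≤ P := by nlinarith
  rcases le_or_gt w ε with hle | hlt
  · refine ⟨0, 0, 0, 0, Reaches.start, D.epsOptimal_zero hle, ?_⟩
    rw [Nat.cast_zero]
    positivity
  set X := P * w / ε with hX
  have hX2 : 2 ≤ X := by
    rw [hX, le_div_iff₀ hε]
    rcases hn with hn | hn
    · have h2 : (2 : ℝ) ≤ Phi A x s h := le_trans (by exact_mod_cast hn) (D.natCast_le_Phi h)
      have hP2 : 2 ≤ P := by nlinarith
      nlinarith
    · nlinarith
  have hlog : 0.69 ≤ Real.log X :=
    le_trans (by linarith [Real.log_two_gt_d9]) (Real.log_le_log two_pos hX2)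
  rw [max_eq_right (by linarith)]
  -- Since `e ^ 8 ≥ 1080`, this many loops reduce the initial error bound to `ε`.
  set N := ⌈8 + Real.log X⌉₊ with hN
  have hN1 : 8 + Real.log X ≤ N := Nat.le_ceil _
  have hN2 : (N : ℝ) ≤ 15 * Real.log X := by
    have := Nat.ceil_lt_add_one (show 0 ≤ 8 + Real.log X by linarith)
    linarith
  have hexp : 1080 * (P * w) * Real.exp (-N) ≤ ε := by
    have h8 : (1080 : ℝ) ≤ Real.exp 8 := by
      have : Real.exp 8 = Real.exp 1 ^ 8 := by rw [← Real.exp_nat_mul]; norm_num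
      rw [this]
      refine le_trans ?_ (pow_le_pow_left₀ (by norm_num) Real.exp_one_gt_d9.le 8)
      norm_num
    have h9 : 1080 * X ≤ Real.exp N := by
      calc 1080 * X ≤ Real.exp 8 * X := mul_le_mul_of_nonneg_right h8 (by linarith)
        _ = Real.exp (8 + Real.log X) := by rw [Real.exp_add, Real.exp_log (by linarith)]
        _ ≤ Real.exp N := Real.exp_le_exp.mpr hN1
    rw [Real.exp_neg, mul_inv_le_iff₀ (Real.exp_pos _)]
    have hXε : P * w = X * ε := by rw [hX]; field_simp
    rw [hXε]
    nlinarith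
  have hT : ∀ T : ℕ, T ≤ 1 + N * loopBound A x s h → (T : ℝ) ≤ 40000 * (P * Real.log X) := by
    intro T hT
    have h1 : (T : ℝ) ≤ 1 + N * loopBound A x s h := by exact_mod_cast hT
    have h2 : (loopBound A x s h : ℝ) ≤ 2001 * P := by
      have := Nat.ceil_lt_add_one (show 0 ≤ 2000 * P by linarith)
      have h3 : (loopBound A x s h : ℝ) < 2000 * P + 1 := this
      linarith
    have h3 : (N : ℝ) * loopBound A x s h ≤ 15 * Real.log X * (2001 * P) :=
      mul_le_mul hN2 h2 (Nat.cast_nonneg _) (by linarith)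
    have h4 : 1 ≤ 2 * (P * Real.log X) := by nlinarith
    nlinarith
  rcases D.exists_reaches h N with ⟨N', T, zprev, z, hR, hz, hle⟩ | ⟨T, zprev, z, hR, hle, hz⟩
  · exact ⟨N', T, zprev, z, hR, D.epsOptimal_of_isSaddlePoint hz hε, hT T hle⟩
  · exact ⟨N + 1, T, zprev, z, hR, D.epsOptimal_of_outerBound h hz hexp, hT T hle⟩

end UniqueOptima

end RPDHG

end

theorem theorem1 :
    ∃ C : ℝ, 0 < C ∧
      ∀ (m n : ℕ) (A : Matrix (Fin m) (Fin n) ℝ) (b : Fin m → ℝ) (c : Fin n → ℝ)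
        (x s : Fin n → ℝ) (y : Fin m → ℝ),
        0 < m →
        LinearIndependent ℝ A.row →
        RPDHG.primalOptima A b c = {x} →
        RPDHG.dualOptima A b c = {(y, s)} →
        A *ᵥ c = 0 →
        ∃ h : (RPDHG.basisSet x).card = m,
          IsUnit (RPDHG.basisMat A x h).det ∧
          (∀ j, j ∉ RPDHG.basisSet x → 0 < s j) ∧
          ∀ ε : ℝ, 0 < ε → (2 ≤ n ∨ ε ≤ ‖RPDHG.pairVec x s‖ / 2) →
            ∃ (N T : ℕ) (zprev z : RPDHG.Iterate m n),
              RPDHG.Reaches A b c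
                (1 / (2 * RPDHG.kappa A))
                (1 / (2 * RPDHG.lamMax A * RPDHG.lamMin A))
                (1 / Real.exp 1) N T zprev z ∧
              RPDHG.EpsOptimal A b c ε (RPDHG.pairVec z.1 (c - Aᵀ *ᵥ z.2)) ∧
              (T : ℝ) ≤ C * (RPDHG.kappa A * RPDHG.Phi A x s h *
                max 0 (Real.log
                  (RPDHG.kappa A * RPDHG.Phi A x s h * ‖RPDHG.pairVec x s‖ / ε))) := by
  refine ⟨40000, by norm_num, fun m n A b c x s y hm hA hx hy hc => ?_⟩
  have D : RPDHG.UniqueOptima A b c x s y := ⟨hm, hA, hx, hy, hc⟩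
  have h := RPDHG.card_basisSet hx hy
  exact ⟨h, RPDHG.isUnit_det_basisMat hx hy h, fun j hj => D.slack_pos hj,
    fun ε hε hn => D.exists_epsOptimal h hε hn⟩
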